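/- Let $\Omega\subset\mathbb{R}^3$ be a bounded domain (non-empty, open, connected) with boundary $\Gamma:=\partial\Omega$, let $\Gamma_\tau\subset\Gamma$ be relatively open, and let $(\Omega,\Gamma_\tau)$ be a weak Lipschitz pair, i.e., with $B:=(-1,1)^3$, there are finitely many open sets $U_1,\dots,U_K\subset\mathbb{R}^3$ covering $\Gamma$ and bijections $\phi_k:U_k\to B$ such that for every $k$ both $\phi_k$ and $\phi_k^{-1}$ are Lipschitz continuous, $\phi_k(U_k\cap\Omega)=\{x\in B: x_3<0\}$, and one of the following holds: - $U_k\cap\Gamma_\tau=\emptyset$; - $U_k\cap\Gamma_\tau=U_k\cap\Gamma$ and $\phi_k(U_k\cap\Gamma_\tau)=\{x\in B: x_3=0\}$; - $\emptyset\neq U_k\cap\Gamma_\tau\neq U_k\cap\Gamma$ and $\phi_k(U_k\cap\Gamma_\tau)=\{x\in B: x_3=0,\ x_1<0\}$. Let $H^1(\Omega)$ be the space of all real-valued $u\in L^2(\Omega)$ with weak gradient $\nabla u\in L^2(\Omega)$, with norm $(\|u\|_{L^2(\Omega)}^2+\|\nabla u\|_{L^2(\Omega)}^2)^{1/2}$,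 and let $\mathring H^1_{\Gamma_\tau}(\Omega)$ be the closure in $H^1(\Omega)$ of the set of all restrictions $\varphi|_\Omega$ of functions $\varphi\in C^\infty(\mathbb{R}^3)$ with compact support and $\operatorname{dist}(\operatorname{supp}\varphi,\Gamma_\tau)>0$ (where $\operatorname{dist}(\cdot,\emptyset)=\infty$). Let $H^1_\perp(\Omega)$ be the set of all $u\in H^1(\Omega)$ that are orthogonal in $L^2(\Omega)$ to the constants. Then: (i) The embedding $\mathring H^1_{\Gamma_\tau}(\Omega)\hookrightarrow L^2(\Omega)$ is compact. (ii) There is a constant $c_p>0$ such that $$\|u\|_{L^2(\Omega)}\le c_p\,\|\nabla u\|_{L^2(\Omega)}$$ holds for all $u\in\mathring H^1_{\Gamma_\tau}(\Omega)$ if $\Gamma_\tau\neq\emptyset$, and for all $u\in H^1_\perp(\Omega)$ if $\Gamma_\tau=\emptyset$. -/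

import Mathlib

open MeasureTheory Set
open scoped ContDiff

noncomputable section

namespace WeakLip

/-- Three-dimensional Euclidean space. -/
abbrev R3 : Type := EuclideanSpace ℝ (Fin 3)

/-! ### Weak Lipschitz pairs -/

/-- The open cube `(-1, 1)³`. -/
def cube : Set R3 := {x | ∀ i, -1 < x i ∧ x i < 1}

/-- The lower half `{x₃ < 0}` of the cube. -/
def cubeNeg : Set R3 := {x ∈ cube | x 2 < 0}

/-- The middle section `{x₃ = 0}` of the cube. -/
def cubeZero : Set R3 := {x ∈ cube | x 2 = 0}

/-- The half `{x₁ < 0}` of the middle section of the cube. -/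
def cubeZeroNeg : Set R3 := {x ∈ cubeZero | x 0 < 0}

/-- `φ` maps the open set `U` bijectively onto the cube, it is Lipschitz on `U`, its inverse is
Lipschitz on the cube, and `U ∩ Ω` corresponds to the lower half of the cube. (Only the values of
`φ` on `U` and of `ψ` on the cube matter.) -/
def IsLipschitzChart (Ω U : Set R3) (φ : R3 → R3) : Prop :=
  IsOpen U ∧ BijOn φ U cube ∧ (∃ L, LipschitzOnWith L φ U) ∧
    (∃ ψ : R3 → R3, InvOn ψ φ U cube ∧ ∃ L, LipschitzOnWith L ψ cube) ∧
    φ '' (U ∩ Ω) = cubeNeg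

/-- `Ω` is weak Lipschitz: its boundary is covered by finitely many Lipschitz charts. -/
def IsWeakLipschitz (Ω : Set R3) : Prop :=
  ∃ (K : ℕ) (U : Fin K → Set R3) (φ : Fin K → R3 → R3),
    frontier Ω ⊆ (⋃ k, U k) ∧ ∀ k, IsLipschitzChart Ω (U k) (φ k)

/-- `(Ω, Γτ)` is a weak Lipschitz pair: `Ω` is weak Lipschitz, `Γτ` is a relatively open subset of
the boundary of `Ω`, and the boundary is covered by finitely many Lipschitz charts each of which
either misses `Γτ`, or sees only `Γτ` on the boundary (then `Γτ` is flattened to the middle section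
of the cube), or flattens `Γτ` to one half of the middle section of the cube. -/
def IsWeakLipschitzPair (Ω Γτ : Set R3) : Prop :=
  IsWeakLipschitz Ω ∧
  (∃ O, IsOpen O ∧ Γτ = O ∩ frontier Ω) ∧
  ∃ (K : ℕ) (U : Fin K → Set R3) (φ : Fin K → R3 → R3),
    frontier Ω ⊆ (⋃ k, U k) ∧ ∀ k, IsLipschitzChart Ω (U k) (φ k) ∧
      (U k ∩ Γτ = ∅ ∨
        (U k ∩ Γτ = U k ∩ frontier Ω ∧ φ k '' (U k ∩ Γτ) = cubeZero) ∨
        (U k ∩ Γτ ≠ ∅ ∧ U k ∩ Γτ ≠ U k ∩ frontier Ω ∧ φ k '' (U k ∩ Γτ) = cubeZeroNeg))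

/-! ### Sobolev spaces -/

/-- The space `L²(Ω)` of real-valued functions. -/
abbrev L2 (Ω : Set R3) : Type := Lp ℝ 2 (volume.restrict Ω)

/-- The space `L²(Ω)` of vector fields. -/
abbrev L2Vec (Ω : Set R3) : Type := Lp R3 2 (volume.restrict Ω)

/-- `g` is the weak (distributional) gradient of `u` in `Ω`. -/
def IsWeakGradient (Ω : Set R3) (u : L2 Ω) (g : L2Vec Ω) : Prop :=
  ∀ η : R3 → ℝ, ContDiff ℝ ∞ η → HasCompactSupport η → tsupport η ⊆ Ω → ∀ i : Fin 3,
    ∫ x in Ω, u x * fderiv ℝ η x (EuclideanSpace.single i 1) = - ∫ x in Ω, g x i * η x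

theorem integrable_mul_cont {Ω : Set R3} (u : L2 Ω) {η : R3 → ℝ} (hη : Continuous η)
    (hc : HasCompactSupport η) : Integrable (fun x => u x * η x) (volume.restrict Ω) :=
  MemLp.integrable_mul (p := 2) (q := 2) (Lp.memLp u) (hη.memLp_of_hasCompactSupport hc)

theorem integrable_coord_mul_cont {Ω : Set R3} (g : L2Vec Ω) {η : R3 → ℝ} (hη : Continuous η)
    (hc : HasCompactSupport η) (i : Fin 3) :
    Integrable (fun x => g x i * η x) (volume.restrict Ω) :=
  MemLp.integrable_mul (p := 2) (q := 2)
    ((EuclideanSpace.proj (𝕜 := ℝ) i : R3 →L[ℝ] ℝ).comp_memLp' (Lp.memLp g))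
    (hη.memLp_of_hasCompactSupport hc)

theorem cont_partial {η : R3 → ℝ} (hη : ContDiff ℝ ∞ η) (v : R3) :
    Continuous fun x => fderiv ℝ η x v :=
  (hη.continuous_fderiv (by simp)).clm_apply continuous_const

theorem IsWeakGradient.add {Ω : Set R3} {u v : L2 Ω} {g h : L2Vec Ω}
    (hu : IsWeakGradient Ω u g) (hv : IsWeakGradient Ω v h) :
    IsWeakGradient Ω (u + v) (g + h) := by
  intro η h1 h2 h3 i
  have hc := cont_partial h1 (EuclideanSpace.single i 1)
  have hs : HasCompactSupport fun x => fderiv ℝ η x (EuclideanSpace.single i 1) :=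
    h2.fderiv_apply ℝ _
  have e1 : ∫ x in Ω, (u + v : L2 Ω) x * fderiv ℝ η x (EuclideanSpace.single i 1)
      = ∫ x in Ω, (u x * fderiv ℝ η x (EuclideanSpace.single i 1)
        + v x * fderiv ℝ η x (EuclideanSpace.single i 1)) := by
    apply integral_congr_ae
    filter_upwards [Lp.coeFn_add u v] with x hx
    rw [hx, Pi.add_apply, add_mul]
  have e2 : ∫ x in Ω, (g + h : L2Vec Ω) x i * η x
      = ∫ x in Ω, (g x i * η x + h x i * η x) := by
    apply integral_congr_ae
    filter_upwards [Lp.coeFn_add g h] with x hx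
    rw [hx, Pi.add_apply, PiLp.add_apply, add_mul]
  rw [e1, e2, integral_add (integrable_mul_cont u hc hs) (integrable_mul_cont v hc hs),
    integral_add (integrable_coord_mul_cont g h1.continuous h2 i)
      (integrable_coord_mul_cont h h1.continuous h2 i), hu η h1 h2 h3 i, hv η h1 h2 h3 i]
  ring

theorem IsWeakGradient.smul {Ω : Set R3} {u : L2 Ω} {g : L2Vec Ω} (c : ℝ)
    (hu : IsWeakGradient Ω u g) : IsWeakGradient Ω (c • u) (c • g) := by
  intro η h1 h2 h3 i
  have e1 : ∫ x in Ω, (c • u : L2 Ω) x * fderiv ℝ η x (EuclideanSpace.single i 1)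
      = ∫ x in Ω, c * (u x * fderiv ℝ η x (EuclideanSpace.single i 1)) := by
    apply integral_congr_ae
    filter_upwards [Lp.coeFn_smul c u] with x hx
    rw [hx, Pi.smul_apply, smul_eq_mul, mul_assoc]
  have e2 : ∫ x in Ω, (c • g : L2Vec Ω) x i * η x = ∫ x in Ω, c * (g x i * η x) := by
    apply integral_congr_ae
    filter_upwards [Lp.coeFn_smul c g] with x hx
    rw [hx, Pi.smul_apply, PiLp.smul_apply, smul_eq_mul, mul_assoc]
  rw [e1, e2, integral_const_mul, integral_const_mul, hu η h1 h2 h3 i, mul_neg]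

theorem IsWeakGradient.zero (Ω : Set R3) : IsWeakGradient Ω 0 0 := by
  intro η _ _ _ i
  have e1 : ∫ x in Ω, (0 : L2 Ω) x * fderiv ℝ η x (EuclideanSpace.single i 1) = 0 := by
    apply integral_eq_zero_of_ae
    filter_upwards [Lp.coeFn_zero ℝ 2 (volume.restrict Ω)] with x hx
    rw [hx]
    simp
  have e2 : ∫ x in Ω, (0 : L2Vec Ω) x i * η x = 0 := by
    apply integral_eq_zero_of_ae
    filter_upwards [Lp.coeFn_zero R3 2 (volume.restrict Ω)] with x hx
    rw [hx]
    simp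
  rw [e1, e2, neg_zero]

/-- The Sobolev space `H¹(Ω)`. A function `u ∈ L²(Ω)` with weak gradient `∇u ∈ L²(Ω)` (which is
unique, as `Ω` is open) is represented by the pair `(u, ∇u)`, so that the norm of `H¹(Ω)` is
`(‖u‖² + ‖∇u‖²)^(1/2)`. -/
def H1 (Ω : Set R3) : Submodule ℝ (WithLp 2 (L2 Ω × L2Vec Ω)) where
  carrier := {p | IsWeakGradient Ω p.fst p.snd}
  add_mem' hp hq := IsWeakGradient.add hp hq
  zero_mem' := IsWeakGradient.zero Ω
  smul_mem' c _ hp := IsWeakGradient.smul c hp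

/-- The embedding `u ↦ u` of `H¹(Ω)` into `L²(Ω)`. -/
def toL2 (Ω : Set R3) : H1 Ω →L[ℝ] L2 Ω :=
  (WithLp.fstL 2 ℝ (L2 Ω) (L2Vec Ω)).comp (H1 Ω).subtypeL

/-- The gradient `u ↦ ∇u` from `H¹(Ω)` to `L²(Ω)`. -/
def grad (Ω : Set R3) : H1 Ω →L[ℝ] L2Vec Ω :=
  (WithLp.sndL 2 ℝ (L2 Ω) (L2Vec Ω)).comp (H1 Ω).subtypeL

/-- `A` and `B` have positive distance (the distance to the empty set being infinite). -/
def PosDist (A B : Set R3) : Prop := ∃ δ > 0, ∀ x ∈ A, ∀ y ∈ B, δ ≤ dist x y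

/-- The restrictions to `Ω` of the smooth functions on `ℝ³` whose support is compact and has
positive distance to `Γτ`, as elements of `H¹(Ω)`. -/
def testFunctions (Ω Γτ : Set R3) : Submodule ℝ (H1 Ω) where
  carrier := {u | ∃ φ : R3 → ℝ, ContDiff ℝ ∞ φ ∧ HasCompactSupport φ ∧
    PosDist (tsupport φ) Γτ ∧ toL2 Ω u =ᵐ[volume.restrict Ω] φ}
  add_mem' := by
    rintro u v ⟨φ, h1, h2, ⟨δ, hδ, h3⟩, h4⟩ ⟨φ', h1', h2', ⟨δ', hδ', h3'⟩, h4'⟩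
    refine ⟨φ + φ', h1.add h1', h2.add h2', ⟨min δ δ', lt_min hδ hδ', ?_⟩, ?_⟩
    · intro x hx y hy
      rcases tsupport_add φ φ' hx with hx | hx
      · exact (min_le_left _ _).trans (h3 x hx y hy)
      · exact (min_le_right _ _).trans (h3' x hx y hy)
    · rw [map_add]
      exact (Lp.coeFn_add _ _).trans (h4.add h4')
  zero_mem' := by
    refine ⟨0, contDiff_const, HasCompactSupport.zero, ⟨1, one_pos, ?_⟩, ?_⟩
    · intro x hx
      simp [tsupport] at hx
    · rw [map_zero]
      exact Lp.coeFn_zero _ _ _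
  smul_mem' := by
    rintro c u ⟨φ, h1, h2, ⟨δ, hδ, h3⟩, h4⟩
    refine ⟨c • φ, h1.const_smul c, h2.smul_left, ⟨δ, hδ, ?_⟩, ?_⟩
    · intro x hx
      exact h3 x (closure_mono (Function.support_const_smul_subset c φ) hx)
    · rw [map_smul]
      exact (Lp.coeFn_smul _ _).trans (h4.const_smul c)

/-- The space `H¹_{Γτ}(Ω)`: the closure in `H¹(Ω)` of the test functions. -/
def H1Gamma (Ω Γτ : Set R3) : Submodule ℝ (H1 Ω) := (testFunctions Ω Γτ).topologicalClosure

/-- The embedding of `H¹_{Γτ}(Ω)`, with the norm of `H¹(Ω)`, into `L²(Ω)`. -/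
def embedding (Ω Γτ : Set R3) : H1Gamma Ω Γτ →L[ℝ] L2 Ω :=
  (toL2 Ω).comp (H1Gamma Ω Γτ).subtypeL

/-- The functions in `H¹(Ω)` that are orthogonal in `L²(Ω)` to the constants. -/
def H1Perp (Ω : Set R3) : Set (H1 Ω) := {u | ∀ c : ℝ, ∫ x in Ω, toL2 Ω u x * c = 0}

end WeakLip

end

namespace WeakLip

open Filter Topology Metric
open scoped ENNReal NNReal Convolution

/-! Both parts rest on Rellich's theorem for all of $H^1(\Omega)$: `toL2` is compact as soon as
$\Omega$ is bounded and weak Lipschitz.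

Rellich follows from a Poincaré inequality on small pieces. Let $\Psi$ be bi-Lipschitz on an open
convex set $Q$ of diameter at most $d$. On $\Psi(Q)\subset\Omega$, $\int|u|^2$ is bounded by the
square of one bounded functional (a multiple of the mean) plus $C d^2\int|\nabla u|^2$, where $C$
depends only on the Lipschitz constants. Cutting a chart by a grid of mesh comparable to $d$ gives
finitely many functionals and a total error $C d^2\|\nabla u\|^2$, since the pieces are disjoint.
Smallness of $d$ yields total boundedness (`isCompactOperator_of_le`).

The local inequality never differentiates $\Psi$. For smooth $w$, the difference
$w(\Psi(y))-w(\Psi(x))$ is bounded by integrating $|\nabla w|\circ\Psi$ along the segment from $x$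
to $y$; volumes are compared through Hausdorff measure. General $u$ are reached by mollification on
compact convex subsets and Fatou's lemma (`lintegral_sub_comp_le_of_isWeakGradient`).

For (ii), a sequence violating the inequality on a closed subspace has, by compactness, a limit in
it with zero gradient and unit norm (`exists_poincare_constant`). Such a limit is constant because
$\Omega$ is connected. Orthogonality to constants excludes it at once. If $\Gamma_\tau\ne\emptyset$,
test functions satisfy $\int_G|q|^2\le K\|\nabla q\|^2$ on a fixed open $G\subset\Omega$ near
$\Gamma_\tau$, and this passes to limits strongly enough to exclude nonzero constants. -/

/-! ### Integration along segments in a convex set -/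

/-- The composition of a `C¹` function with a Lipschitz map is controlled along a segment by the
integral of the derivative of the function, although the Lipschitz map need not be differentiable. -/
theorem abs_sub_le_integral_segment {w : R3 → ℝ} (hw : ContDiff ℝ 1 w) {Ψ : R3 → R3} {L : ℝ≥0}
    (hΨ : LipschitzWith L Ψ) (x v : R3) {T : ℝ} (hT : 0 ≤ T) :
    |w (Ψ (x + T • v)) - w (Ψ x)| ≤
      ∫ t in (0 : ℝ)..T, L * ‖v‖ * ‖fderiv ℝ w (Ψ (x + t • v))‖ := by
  set M : ℝ := L * ‖v‖ with hM
  have hM0 : 0 ≤ M := by positivity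
  have hγ : Continuous fun t : ℝ => Ψ (x + t • v) := hΨ.continuous.comp (by fun_prop)
  set k : ℝ → ℝ := fun t => M * ‖fderiv ℝ w (Ψ (x + t • v))‖ with hk
  have hkc : Continuous k :=
    continuous_const.mul (((hw.continuous_fderiv (by simp)).comp hγ).norm)
  refine le_of_forall_pos_le_add fun ε hε => ?_
  -- The comparison principle needs a bound growing strictly faster than the function, hence the
  -- extra term $\frac{\varepsilon}{T+1}t\le\varepsilon$; the $+1$ covers $T=0$.
  have key := image_norm_le_of_liminf_right_slope_norm_lt_deriv_boundary
    (f := fun t : ℝ => w (Ψ (x + t • v)) - w (Ψ x)) (f' := k) (a := 0) (b := T)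
    (B := fun t => (∫ s in (0 : ℝ)..t, k s) + ε / (T + 1) * t) (B' := fun t => k t + ε / (T + 1))
    ((hw.continuous.comp hγ).sub continuous_const).continuousOn ?_ (by simp) ?_ ?_ ?_
    (right_mem_Icc.2 hT)
  · rw [Real.norm_eq_abs] at key
    refine key.trans (add_le_add le_rfl ?_)
    rw [div_mul_eq_mul_div, div_le_iff₀ (by positivity)]
    nlinarith
  · intro t _ r hr
    apply Eventually.frequently
    have hd := (hw.differentiable (by simp) (Ψ (x + t • v))).hasFDerivAt
    set D := fderiv ℝ w (Ψ (x + t • v))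
    have hr' : M * ‖D‖ < r := hr
    set δ := (r - M * ‖D‖) / (M + 1)
    have hδ : 0 < δ := div_pos (by linarith) (by linarith)
    have hMδ : M * δ < r - M * ‖D‖ := by
      have : (M + 1) * δ = r - M * ‖D‖ := mul_div_cancel₀ _ (by positivity)
      nlinarith
    have h1 := hγ.continuousAt.eventually (hd.isLittleO.def hδ)
    filter_upwards [h1.filter_mono nhdsWithin_le_nhds, self_mem_nhdsWithin] with z hz hzt
    have hzt' : 0 < z - t := sub_pos.2 hzt
    have h2 : ‖Ψ (x + z • v) - Ψ (x + t • v)‖ ≤ M * (z - t) := by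
      have := hΨ.dist_le_mul (x + z • v) (x + t • v)
      rw [dist_eq_norm, dist_eq_norm, add_sub_add_left_eq_sub, ← sub_smul, norm_smul,
        Real.norm_of_nonneg hzt'.le] at this
      calc _ ≤ _ := this
        _ = _ := by rw [hM]; ring
    have h3 : |w (Ψ (x + z • v)) - w (Ψ (x + t • v))| ≤ (‖D‖ + δ) * (M * (z - t)) := by
      rw [← Real.norm_eq_abs]
      calc _ = ‖(w (Ψ (x + z • v)) - w (Ψ (x + t • v)) - D (Ψ (x + z • v) - Ψ (x + t • v)))
              + D (Ψ (x + z • v) - Ψ (x + t • v))‖ := by rw [sub_add_cancel]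
        _ ≤ _ := norm_add_le _ _
        _ ≤ δ * ‖Ψ (x + z • v) - Ψ (x + t • v)‖ + ‖D‖ * ‖Ψ (x + z • v) - Ψ (x + t • v)‖ :=
            add_le_add hz (D.le_opNorm _)
        _ = (‖D‖ + δ) * ‖Ψ (x + z • v) - Ψ (x + t • v)‖ := by ring
        _ ≤ _ := mul_le_mul_of_nonneg_left h2 (by positivity)
    rw [slope_def_field, div_lt_iff₀ hzt']
    have h4 := abs_norm_sub_norm_le (w (Ψ (x + z • v)) - w (Ψ x)) (w (Ψ (x + t • v)) - w (Ψ x))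
    rw [sub_sub_sub_cancel_right] at h4
    calc _ ≤ _ := (le_abs_self _).trans h4
      _ ≤ _ := h3
      _ = (M * ‖D‖ + M * δ) * (z - t) := by ring
      _ < r * (z - t) := mul_lt_mul_of_pos_right (by linarith) hzt'
  · exact ((intervalIntegral.continuous_primitive (fun a b => hkc.intervalIntegrable a b) 0).add
      (by fun_prop)).continuousOn
  · intro t _
    have h1 := intervalIntegral.integral_hasDerivAt_right (hkc.intervalIntegrable 0 t)
      (hkc.stronglyMeasurableAtFilter _ _) hkc.continuousAt
    have h2 := h1.add ((hasDerivAt_id t).const_mul (ε / (T + 1)))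
    rw [mul_one] at h2
    exact h2.hasDerivWithinAt
  · intro t _ _
    have : 0 < ε / (T + 1) := by positivity
    linarith

theorem sq_lintegral_le {α : Type*} [MeasurableSpace α] (μ : Measure α) {f : α → ℝ≥0∞}
    (hf : AEMeasurable f μ) : (∫⁻ a, f a ∂μ) ^ 2 ≤ μ univ * ∫⁻ a, f a ^ 2 ∂μ := by
  have h := ENNReal.lintegral_mul_le_Lp_mul_Lq μ Real.HolderConjugate.two_two
    (aemeasurable_const (b := (1 : ℝ≥0∞))) hf
  simp only [Pi.mul_apply, one_mul, ENNReal.one_rpow, lintegral_const, one_div] at h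
  calc _ ≤ (μ univ ^ (2⁻¹ : ℝ) * (∫⁻ a, f a ^ (2 : ℝ) ∂μ) ^ (2⁻¹ : ℝ)) ^ 2 := by gcongr
    _ = _ := by
      rw [mul_pow, ← ENNReal.rpow_natCast, ← ENNReal.rpow_natCast, ← ENNReal.rpow_mul,
        ← ENNReal.rpow_mul]
      simp

/-- This is the unweighted Cauchy–Schwarz inequality for the measure with density `ρ`. -/
theorem sq_lintegral_mul_le {α : Type*} [MeasurableSpace α] (μ : Measure α) {ρ f : α → ℝ≥0∞}
    (hρ : Measurable ρ) (hf : AEMeasurable f μ) :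
    (∫⁻ a, ρ a * f a ∂μ) ^ 2 ≤ (∫⁻ a, ρ a ∂μ) * ∫⁻ a, ρ a * f a ^ 2 ∂μ := by
  have h := sq_lintegral_le (μ.withDensity ρ) (f := f)
    (hf.mono_ac (withDensity_absolutelyContinuous _ _))
  rw [withDensity_apply _ MeasurableSet.univ, Measure.restrict_univ,
    lintegral_withDensity_eq_lintegral_mul₀ hρ.aemeasurable hf,
    lintegral_withDensity_eq_lintegral_mul₀ hρ.aemeasurable (hf.pow_const 2)] at h
  exact h

theorem enorm_sub_sq_le_lintegral_segment {w : R3 → ℝ} (hw : ContDiff ℝ 1 w) {Ψ : R3 → R3}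
    {L : ℝ≥0} (hΨ : LipschitzWith L Ψ) (x v : R3) {T : ℝ} (hT : 0 ≤ T) (hT1 : T ≤ 1) :
    ‖w (Ψ (x + T • v)) - w (Ψ x)‖ₑ ^ 2 ≤
      (L * ‖v‖ₑ) ^ 2 * ∫⁻ t in Ioc (0 : ℝ) T, ‖fderiv ℝ w (Ψ (x + t • v))‖ₑ ^ 2 := by
  have hγ : Continuous fun t : ℝ => Ψ (x + t • v) := hΨ.continuous.comp (by fun_prop)
  have hc : Continuous fun t : ℝ => fderiv ℝ w (Ψ (x + t • v)) :=
    (hw.continuous_fderiv (by simp)).comp hγ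
  have h1 := abs_sub_le_integral_segment hw hΨ x v hT
  rw [intervalIntegral.integral_of_le hT] at h1
  have h2 : ‖w (Ψ (x + T • v)) - w (Ψ x)‖ₑ ≤
      ∫⁻ t in Ioc (0 : ℝ) T, (L * ‖v‖ₑ) * ‖fderiv ℝ w (Ψ (x + t • v))‖ₑ := by
    rw [Real.enorm_eq_ofReal_abs]
    refine (ENNReal.ofReal_le_ofReal h1).trans ?_
    refine (Real.ofReal_le_enorm _).trans ((enorm_integral_le_lintegral_enorm _).trans (le_of_eq ?_))
    simp only [enorm_mul, enorm_norm]
    simp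
  calc _ ≤ (∫⁻ t in Ioc (0 : ℝ) T, (L * ‖v‖ₑ) * ‖fderiv ℝ w (Ψ (x + t • v))‖ₑ) ^ 2 := by gcongr
    _ ≤ _ := by
      rw [lintegral_const_mul _ hc.enorm.measurable, mul_pow]
      gcongr
      refine (sq_lintegral_le _ hc.enorm.aemeasurable).trans ?_
      rw [Measure.restrict_apply_univ, Real.volume_Ioc]
      refine (mul_le_mul_left (b := ENNReal.ofReal (T - 0)) (c := 1) ?_ _).trans (one_mul _).le
      simpa using hT1

theorem lintegral_comp_smul_add {h : R3 → ℝ≥0∞} (hh : Measurable h) {t : ℝ} (ht : 1 / 2 ≤ t)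
    (b : R3) : ∫⁻ y, h (t • y + b) ≤ 8 * ∫⁻ z, h z := by
  have ht0 : t ≠ 0 := by linarith
  have e1 : ∫⁻ y, h (t • y + b) = ∫⁻ z, h (z + b) ∂(Measure.map (t • ·) volume) := by
    rw [lintegral_map (by fun_prop) (by fun_prop)]
  rw [e1, Measure.map_addHaar_smul _ ht0, lintegral_smul_measure, lintegral_add_right_eq_self h b]
  rw [smul_eq_mul]
  gcongr
  rw [show (8 : ℝ≥0∞) = ENNReal.ofReal 8 by simp]
  apply ENNReal.ofReal_le_ofReal
  have h8 : (1 / 8 : ℝ) ≤ t ^ 3 := by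
    calc (1 / 8 : ℝ) = (1 / 2) ^ 3 := by norm_num
      _ ≤ t ^ 3 := by gcongr
  rw [finrank_euclideanSpace_fin, abs_of_nonneg (by positivity)]
  calc (t ^ 3)⁻¹ ≤ (1 / 8 : ℝ)⁻¹ := inv_anti₀ (by norm_num) h8
    _ = 8 := by norm_num

/-- By convexity $y\mapsto x+t(y-x)$ maps $Q$ into itself, and its Jacobian $t^3$ is at least $1/8$.
-/
theorem setLIntegral_segment_le {Q : Set R3} (hQ : Convex ℝ Q) (hQm : MeasurableSet Q)
    {h : R3 → ℝ≥0∞} (hh : Measurable h) {x : R3} (hx : x ∈ Q) {t : ℝ} (ht : 1 / 2 ≤ t)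
    (ht1 : t ≤ 1) : ∫⁻ y in Q, h (x + t • (y - x)) ≤ 8 * ∫⁻ z in Q, h z := by
  rw [← lintegral_indicator hQm, ← lintegral_indicator hQm]
  refine le_trans (lintegral_mono fun y => ?_)
    (lintegral_comp_smul_add (hh.indicator hQm) ht (x - t • x))
  by_cases hy : y ∈ Q
  · have e : t • y + (x - t • x) = x + t • (y - x) := by module
    rw [indicator_of_mem hy, e, indicator_of_mem]
    have := hQ hx hy (by linarith : 0 ≤ 1 - t) (by linarith : 0 ≤ t) (by ring)
    convert this using 1
    module
  · rw [indicator_of_notMem hy]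
    exact zero_le

/-- For $t\ge 1/2$ substitute in $y$; for $t\le 1/2$ exchange the endpoints and substitute in $x$.
The Jacobian thus never degenerates. -/
theorem lintegral_segment_le {Q : Set R3} (hQ : Convex ℝ Q) (hQm : MeasurableSet Q)
    {h : R3 → ℝ≥0∞} (hh : Measurable h) :
    ∫⁻ x in Q, ∫⁻ y in Q, ∫⁻ t in Ioc (0 : ℝ) 1, h (x + t • (y - x)) ≤
      8 * volume Q * ∫⁻ z in Q, h z := by
  have hm : Measurable fun p : (ℝ × R3) × R3 => h (p.1.2 + p.1.1 • (p.2 - p.1.2)) := by fun_prop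
  have hpt : ∀ t ∈ Ioc (0 : ℝ) 1,
      ∫⁻ x in Q, ∫⁻ y in Q, h (x + t • (y - x)) ≤ 8 * volume Q * ∫⁻ z in Q, h z := by
    intro t ht
    have hconst : ∫⁻ _ in Q, 8 * ∫⁻ z in Q, h z = 8 * volume Q * ∫⁻ z in Q, h z := by
      rw [setLIntegral_const]; ring
    rcases le_total (1 / 2) t with h2 | h2
    · exact (setLIntegral_mono' hQm fun x hx =>
        setLIntegral_segment_le hQ hQm hh hx h2 ht.2).trans_eq hconst
    · rw [lintegral_lintegral_swap (by fun_prop)]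
      refine (setLIntegral_mono' hQm fun y hy => ?_).trans_eq hconst
      have := setLIntegral_segment_le hQ hQm hh hy (by linarith : 1 / 2 ≤ 1 - t) (by linarith [ht.1])
      refine le_of_eq_of_le (lintegral_congr fun x => ?_) this
      congr 1
      module
  calc _ = ∫⁻ x in Q, ∫⁻ t in Ioc (0 : ℝ) 1, ∫⁻ y in Q, h (x + t • (y - x)) := by
        refine lintegral_congr fun x => ?_
        rw [lintegral_lintegral_swap (by fun_prop)]
    _ = ∫⁻ t in Ioc (0 : ℝ) 1, ∫⁻ x in Q, ∫⁻ y in Q, h (x + t • (y - x)) := by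
        rw [lintegral_lintegral_swap]
        have : Measurable fun p : R3 × ℝ => ∫⁻ y in Q, h (p.1 + p.2 • (y - p.1)) :=
          Measurable.lintegral_prod_right' (f := fun p : (R3 × ℝ) × R3 =>
            h (p.1.1 + p.1.2 • (p.2 - p.1.1))) (by fun_prop)
        exact this.aemeasurable
    _ ≤ ∫⁻ t in Ioc (0 : ℝ) 1, 8 * volume Q * ∫⁻ z in Q, h z :=
        setLIntegral_mono' measurableSet_Ioc hpt
    _ = _ := by rw [setLIntegral_const]; simp

/-! ### Volume distortion and mollification -/

/-- A Lipschitz map increases the volume at most by a fixed factor. -/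
theorem volume_image_le {f : R3 → R3} {K : ℝ≥0} (hf : LipschitzWith K f) (A : Set R3) :
    volume (f '' A) ≤ (K : ℝ≥0∞) ^ 3 * volume A := by
  rw [← EuclideanSpace.euclideanHausdorffMeasure_eq_volume,
    Measure.euclideanHausdorffMeasure_def, Measure.smul_apply, Measure.smul_apply, ENNReal.smul_def,
    ENNReal.smul_def, smul_eq_mul, smul_eq_mul, mul_left_comm]
  gcongr
  simpa using hf.hausdorffMeasure_image_le (d := (3 : ℕ)) (by positivity) A

/-- The mollification of an `L²` function on `Ω`, extended by zero. -/
noncomputable def mollify (Ω : Set R3) (u : L2 Ω) (ρ : ContDiffBump (0 : R3)) : R3 → ℝ :=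
  ρ.normed volume ⋆[ContinuousLinearMap.lsmul ℝ ℝ, volume] Ω.indicator u

theorem locallyIntegrable_indicator {Ω : Set R3} (hΩ : MeasurableSet Ω) (u : L2 Ω) :
    LocallyIntegrable (Ω.indicator u) volume :=
  ((memLp_indicator_iff_restrict hΩ).2 (Lp.memLp u)).locallyIntegrable (by norm_num)

theorem contDiff_mollify {Ω : Set R3} (hΩ : MeasurableSet Ω) (u : L2 Ω)
    (ρ : ContDiffBump (0 : R3)) : ContDiff ℝ 1 (mollify Ω u ρ) :=
  ρ.hasCompactSupport_normed.contDiff_convolution_left _ ρ.contDiff_normed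
    (locallyIntegrable_indicator hΩ u)

theorem ae_tendsto_mollify {Ω : Set R3} (hΩ : MeasurableSet Ω) (u : L2 Ω)
    {ρ : ℕ → ContDiffBump (0 : R3)} (h0 : Tendsto (fun n => (ρ n).rOut) atTop (𝓝 0))
    (h2 : ∀ n, (ρ n).rOut ≤ 2 * (ρ n).rIn) :
    ∀ᵐ x, Tendsto (fun n => mollify Ω u (ρ n) x) atTop (𝓝 (Ω.indicator u x)) :=
  ContDiffBump.ae_convolution_tendsto_right_of_locallyIntegrable h0 (Eventually.of_forall h2)
    (locallyIntegrable_indicator hΩ u)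

/-- The reflected bump $y\mapsto\rho(x-y)$ is an admissible test function exactly because the ball
around $x$ stays in $\Omega$; the jump of the zero extension is not seen. -/
theorem fderiv_mollify_apply {Ω : Set R3} (hΩ : MeasurableSet Ω) {u : L2 Ω} {g : L2Vec Ω}
    (hu : IsWeakGradient Ω u g) (ρ : ContDiffBump (0 : R3)) {x : R3}
    (hx : closedBall x ρ.rOut ⊆ Ω) (i : Fin 3) :
    fderiv ℝ (mollify Ω u ρ) x (EuclideanSpace.single i 1) =
      ∫ y in Ω, g y i * ρ.normed volume (x - y) := by
  set ν := ρ.normed (volume : Measure R3) with hν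
  have hνs : ContDiff ℝ ∞ ν := ρ.contDiff_normed (n := ⊤)
  set η : R3 → ℝ := fun y => ν (x - y) with hη
  have hηs : ContDiff ℝ ∞ η := hνs.comp (contDiff_const.sub contDiff_id)
  have hηt : tsupport η ⊆ closedBall x ρ.rOut := by
    refine closure_minimal (fun y hy => ?_) isClosed_closedBall
    have : x - y ∈ Function.support ν := hy
    rw [hν, ρ.support_normed_eq, mem_ball_zero_iff] at this
    rw [mem_closedBall, dist_comm, dist_eq_norm]
    exact this.le
  have hηc : HasCompactSupport η :=
    (isCompact_closedBall x ρ.rOut).of_isClosed_subset (isClosed_tsupport _) hηt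
  have hηd : ∀ y, fderiv ℝ η y (EuclideanSpace.single i 1)
      = - fderiv ℝ ν (x - y) (EuclideanSpace.single i 1) := by
    intro y
    have h1 : HasFDerivAt (fun y : R3 => x - y) (-ContinuousLinearMap.id ℝ R3) y :=
      (hasFDerivAt_id y).const_sub x
    have h2 := (hνs.differentiable (by simp) (x - y)).hasFDerivAt.comp y h1
    have h3 : fderiv ℝ η y = _ := h2.fderiv
    rw [h3]
    simp
  have hw := hu η hηs hηc (hηt.trans hx) i
  have hd := (ρ.hasCompactSupport_normed (μ := volume)).hasFDerivAt_convolution_left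
    (ContinuousLinearMap.lsmul ℝ ℝ) ρ.contDiff_normed (locallyIntegrable_indicator hΩ u) x
  have hd' : fderiv ℝ (mollify Ω u ρ) x = _ := hd.fderiv
  have hex := (ρ.hasCompactSupport_normed (μ := volume)).fderiv ℝ |>.convolutionExists_left
    ((ContinuousLinearMap.lsmul ℝ ℝ).precompL R3) (hνs.continuous_fderiv (by simp))
    (locallyIntegrable_indicator hΩ u) x
  rw [hd', convolution_eq_swap, ContinuousLinearMap.integral_apply hex.integrable_swap]
  simp_rw [hηd] at hw
  rw [← neg_eq_iff_eq_neg, ← integral_neg] at hw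
  rw [← hw, ← integral_indicator hΩ]
  refine integral_congr_ae (Eventually.of_forall fun y => ?_)
  by_cases hy : y ∈ Ω
  · simp [hy, ContinuousLinearMap.precompL_apply, hν]
    ring
  · simp [hy]

/-- Jensen's inequality for the probability density $\rho(x-\cdot)$, which is supported in $G$. -/
theorem enorm_fderiv_mollify_sq_le {Ω G : Set R3} (hΩ : MeasurableSet Ω) (hG : MeasurableSet G)
    (hGΩ : G ⊆ Ω) {u : L2 Ω} {g : L2Vec Ω}
    (hu : IsWeakGradient Ω u g) (ρ : ContDiffBump (0 : R3)) {x : R3}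
    (hx : closedBall x ρ.rOut ⊆ G) :
    ‖fderiv ℝ (mollify Ω u ρ) x‖ₑ ^ 2 ≤
      ∫⁻ y in G, ‖ρ.normed volume (x - y)‖ₑ * ‖g y‖ₑ ^ 2 := by
  set ν := ρ.normed (volume : Measure R3) with hν
  have hνc : Continuous ν := ρ.continuous_normed
  have hνi : Integrable ν := ρ.integrable_normed
  have hηc : HasCompactSupport fun y => ν (x - y) :=
    (ρ.hasCompactSupport_normed (μ := volume)).comp_homeomorph (Homeomorph.subLeft x)
  have h0 : ∀ y ∉ G, ν (x - y) = 0 := by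
    intro y hy
    by_contra h
    have : x - y ∈ Function.support ν := h
    rw [hν, ρ.support_normed_eq, mem_ball_zero_iff] at this
    exact hy (hx (by rw [mem_closedBall, dist_comm, dist_eq_norm]; exact this.le))
  have hone : ∫⁻ y, ‖ν (x - y)‖ₑ = 1 := by
    rw [lintegral_sub_left_eq_self (fun y => ‖ν y‖ₑ) x,
      ← ofReal_integral_norm_eq_lintegral_enorm hνi]
    simp_rw [hν, Real.norm_of_nonneg (ρ.nonneg_normed _)]
    rw [ρ.integral_normed, ENNReal.ofReal_one]
  have hgm : AEMeasurable (fun y => ‖g y‖ₑ) (volume.restrict Ω) := (Lp.aestronglyMeasurable g).enorm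
  set I : ℝ≥0∞ := ∫⁻ y in Ω, ‖ν (x - y)‖ₑ * ‖g y‖ₑ with hI
  have hint : Integrable (fun y => ν (x - y) * ‖g y‖) (volume.restrict Ω) :=
    MemLp.integrable_mul (p := 2) (q := 2)
      ((hνc.comp (continuous_const.sub continuous_id)).memLp_of_hasCompactSupport hηc)
      (Lp.memLp g).norm
  have hnorm : ‖fderiv ℝ (mollify Ω u ρ) x‖ ≤ ∫ y in Ω, ν (x - y) * ‖g y‖ := by
    refine ContinuousLinearMap.opNorm_le_bound _
      (integral_nonneg fun y => mul_nonneg (ρ.nonneg_normed _) (norm_nonneg _)) fun v => ?_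
    have hv : v = ∑ i, v i • EuclideanSpace.single i (1 : ℝ) := by
      ext j
      simp [Pi.single_apply]
    have e1 : fderiv ℝ (mollify Ω u ρ) x v = ∫ y in Ω, ∑ i, v i * (g y i * ν (x - y)) := by
      conv_lhs => rw [hv]
      rw [map_sum, integral_finsetSum]
      · refine Finset.sum_congr rfl fun i _ => ?_
        rw [map_smul, fderiv_mollify_apply hΩ hu ρ (hx.trans hGΩ), integral_const_mul, smul_eq_mul]
      · exact fun i _ => (integrable_coord_mul_cont g
          (hνc.comp (continuous_const.sub continuous_id)) hηc i).const_mul _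
    rw [e1, ← integral_mul_const]
    refine norm_integral_le_of_norm_le (hint.mul_const _) (Eventually.of_forall fun y => ?_)
    -- Recombining the components into a Euclidean inner product avoids a dimensional constant.
    have e2 : ∑ i, v i * (g y i * ν (x - y)) = ν (x - y) * inner ℝ (g y) v := by
      rw [PiLp.inner_apply, Finset.mul_sum]
      refine Finset.sum_congr rfl fun i _ => ?_
      simp only [RCLike.inner_apply, conj_trivial]
      ring
    rw [e2, norm_mul, Real.norm_of_nonneg (ρ.nonneg_normed _), mul_assoc]
    exact mul_le_mul_of_nonneg_left (norm_inner_le_norm _ _) (ρ.nonneg_normed _)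
  have hle : ‖fderiv ℝ (mollify Ω u ρ) x‖ₑ ≤ I := by
    rw [← ofReal_norm]
    refine (ENNReal.ofReal_le_ofReal hnorm).trans ((Real.ofReal_le_enorm _).trans
      ((enorm_integral_le_lintegral_enorm _).trans (le_of_eq ?_)))
    simp only [enorm_mul, enorm_norm, hI]
  calc _ ≤ I ^ 2 := by gcongr
    _ ≤ (∫⁻ y in Ω, ‖ν (x - y)‖ₑ) * ∫⁻ y in Ω, ‖ν (x - y)‖ₑ * ‖g y‖ₑ ^ 2 :=
        sq_lintegral_mul_le _
          (hνc.comp (continuous_const.sub continuous_id)).enorm.measurable hgm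
    _ ≤ 1 * ∫⁻ y in Ω, ‖ν (x - y)‖ₑ * ‖g y‖ₑ ^ 2 := by
        gcongr
        exact (setLIntegral_le_lintegral _ _).trans hone.le
    _ = _ := by
        rw [one_mul, ← lintegral_indicator hΩ, ← lintegral_indicator hG]
        refine lintegral_congr fun y => ?_
        by_cases hy : y ∈ G
        · rw [indicator_of_mem hy, indicator_of_mem (hGΩ hy)]
        · rw [indicator_of_notMem hy]
          refine indicator_apply_eq_zero.2 fun _ => ?_
          rw [h0 y hy, enorm_zero, zero_mul]

theorem lintegral_mollifier {g : R3 → ℝ≥0∞} {G : Set R3} (hg : AEMeasurable g (volume.restrict G))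
    (ρ : ContDiffBump (0 : R3)) :
    ∫⁻ x, ∫⁻ y in G, ‖ρ.normed volume (x - y)‖ₑ * g y = ∫⁻ y in G, g y := by
  set ν := ρ.normed (volume : Measure R3) with hν
  have hνc : Continuous ν := ρ.continuous_normed
  rw [lintegral_lintegral_swap]
  · refine lintegral_congr fun y => ?_
    have hm : Measurable fun x => ‖ν (x - y)‖ₑ :=
      (hνc.comp (continuous_id.sub continuous_const)).enorm.measurable
    rw [lintegral_mul_const _ hm, lintegral_sub_right_eq_self (fun x => ‖ν x‖ₑ) y,
      ← ofReal_integral_norm_eq_lintegral_enorm ρ.integrable_normed]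
    simp_rw [Real.norm_of_nonneg (ρ.nonneg_normed _)]
    rw [ρ.integral_normed, ENNReal.ofReal_one, one_mul]
  · exact AEMeasurable.mul (hνc.comp (continuous_fst.sub continuous_snd)).enorm.aemeasurable hg.comp_snd

/-! ### Changes of variables as inequalities -/

/-- The pushforward of volume on `A` is dominated by a multiple of volume on the image: the part of
`A` sent into `S` is contained in the `φ`-image of `S ∩ Ψ '' A`. No Jacobian is involved. -/
theorem setLIntegral_comp_le {Ψ φ : R3 → R3} {L' : ℝ≥0} {A : Set R3} (hΨ : Continuous Ψ)
    (hφ : LipschitzWith L' φ) (hinv : LeftInvOn φ Ψ A) {h : R3 → ℝ≥0∞} (hh : Measurable h) :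
    ∫⁻ x in A, h (Ψ x) ≤ (L' : ℝ≥0∞) ^ 3 * ∫⁻ y in Ψ '' A, h y := by
  rw [← lintegral_map hh hΨ.measurable, ← smul_eq_mul, ← lintegral_smul_measure]
  refine lintegral_mono' (Measure.le_iff.2 fun S hS => ?_) le_rfl
  rw [Measure.map_apply hΨ.measurable hS, Measure.restrict_apply (hΨ.measurable hS),
    Measure.smul_apply, Measure.restrict_apply hS, smul_eq_mul]
  refine le_trans (measure_mono ?_) (volume_image_le hφ (S ∩ Ψ '' A))
  rintro x ⟨hxS, hxA⟩
  exact ⟨Ψ x, ⟨hxS, mem_image_of_mem _ hxA⟩, hinv hxA⟩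

theorem setLIntegral_image_le {Ψ : R3 → R3} {L : ℝ≥0} {A : Set R3} (hΨ : LipschitzWith L Ψ)
    {h : R3 → ℝ≥0∞} (hh : Measurable h) :
    ∫⁻ y in Ψ '' A, h y ≤ (L : ℝ≥0∞) ^ 3 * ∫⁻ x in A, h (Ψ x) := by
  have hm := hΨ.continuous.measurable
  rw [← lintegral_map hh hm, ← smul_eq_mul, ← lintegral_smul_measure]
  refine lintegral_mono' (Measure.le_iff.2 fun S hS => ?_) le_rfl
  rw [Measure.smul_apply, Measure.map_apply hm hS, Measure.restrict_apply (hm hS),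
    Measure.restrict_apply hS, smul_eq_mul]
  refine le_trans (measure_mono ?_) (volume_image_le hΨ (Ψ ⁻¹' S ∩ A))
  rintro _ ⟨hxS, x, hxA, rfl⟩
  exact ⟨x, ⟨hxS, hxA⟩, rfl⟩

/-! ### Convex exhaustion and the double-integral Poincaré inequality -/

/-- The points of distance at least `δ` from the complement of `Q`. -/
def erosion (δ : ℝ) (Q : Set R3) : Set R3 := {x | ball x δ ⊆ Q}

theorem isClosed_erosion (δ : ℝ) (Q : Set R3) : IsClosed (erosion δ Q) := by
  rw [← isOpen_compl_iff, Metric.isOpen_iff]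
  intro x hx
  simp only [erosion, mem_compl_iff, mem_ofPred_eq, not_subset] at hx
  obtain ⟨p, hp, hpQ⟩ := hx
  refine ⟨δ - dist p x, sub_pos.2 hp, fun y hy => ?_⟩
  simp only [erosion, mem_compl_iff, mem_ofPred_eq, not_subset]
  refine ⟨p, ?_, hpQ⟩
  rw [mem_ball] at hy ⊢
  linarith [dist_triangle p x y, dist_comm x y]

theorem convex_erosion {δ : ℝ} {Q : Set R3} (hQ : Convex ℝ Q) : Convex ℝ (erosion δ Q) := by
  intro x hx y hy a b ha hb hab z hz
  set v := z - (a • x + b • y) with hv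
  have hvδ : ‖v‖ < δ := by rwa [hv, ← dist_eq_norm]
  have h1 : x + v ∈ Q := hx (by simpa [mem_ball, dist_eq_norm] using hvδ)
  have h2 : y + v ∈ Q := hy (by simpa [mem_ball, dist_eq_norm] using hvδ)
  have := hQ h1 h2 ha hb hab
  have e : a • (x + v) + b • (y + v) = z := by
    rw [smul_add, smul_add, add_add_add_comm, ← add_smul, hab, one_smul, hv]
    abel
  rwa [e] at this

theorem erosion_subset {δ : ℝ} (hδ : 0 < δ) (Q : Set R3) : erosion δ Q ⊆ Q :=
  fun x hx => hx (mem_ball_self hδ)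

theorem eventually_mem_erosion {Q : Set R3} (hQ : IsOpen Q) {x : R3} (hx : x ∈ Q) :
    ∀ᶠ n : ℕ in atTop, x ∈ erosion (1 / ((n : ℝ) + 1)) Q := by
  obtain ⟨ε, hε, h⟩ := Metric.isOpen_iff.1 hQ x hx
  filter_upwards [tendsto_one_div_add_atTop_nhds_zero_nat.eventually_lt_const hε] with n hn
  exact (ball_subset_ball hn.le).trans h

theorem lintegral_sub_comp_le {w : R3 → ℝ} (hw : ContDiff ℝ 1 w) {Ψ : R3 → R3} {L d : ℝ≥0}
    (hΨ : LipschitzWith L Ψ) {E : Set R3} (hE : Convex ℝ E) (hEm : MeasurableSet E)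
    (hd : ∀ x ∈ E, ∀ y ∈ E, dist x y ≤ d) :
    ∫⁻ x in E, ∫⁻ y in E, ‖w (Ψ y) - w (Ψ x)‖ₑ ^ 2 ≤
      (L * d) ^ 2 * (8 * volume E * ∫⁻ z in E, ‖fderiv ℝ w (Ψ z)‖ₑ ^ 2) := by
  have hh : Measurable fun z => ‖fderiv ℝ w (Ψ z)‖ₑ ^ 2 :=
    (((hw.continuous_fderiv (by simp)).comp hΨ.continuous).enorm.measurable).pow_const 2
  set J : R3 × R3 → ℝ≥0∞ := fun p =>
    ∫⁻ t in Ioc (0 : ℝ) 1, ‖fderiv ℝ w (Ψ (p.1 + t • (p.2 - p.1)))‖ₑ ^ 2 with hJ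
  have hm : Measurable J :=
    Measurable.lintegral_prod_right' (f := fun q : (R3 × R3) × ℝ =>
      ‖fderiv ℝ w (Ψ (q.1.1 + q.2 • (q.1.2 - q.1.1)))‖ₑ ^ 2)
      (hh.comp (g := fun z => ‖fderiv ℝ w (Ψ z)‖ₑ ^ 2)
        (f := fun q : (R3 × R3) × ℝ => q.1.1 + q.2 • (q.1.2 - q.1.1)) (by fun_prop))
  have hle : ∀ x ∈ E, ∀ y ∈ E, ‖w (Ψ y) - w (Ψ x)‖ₑ ^ 2 ≤ (L * d : ℝ≥0∞) ^ 2 * J (x, y) := by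
    intro x hx y hy
    have h := enorm_sub_sq_le_lintegral_segment hw hΨ x (y - x) zero_le_one le_rfl
    rw [one_smul, add_sub_cancel] at h
    refine h.trans (mul_le_mul_left ?_ _)
    gcongr
    have := hd y hy x hx
    rw [dist_eq_norm, ← coe_nnnorm, NNReal.coe_le_coe] at this
    exact_mod_cast this
  have hsec : ∀ x, Measurable fun y => J (x, y) := fun x => hm.comp measurable_prodMk_left
  have hint : Measurable fun x => ∫⁻ y in E, J (x, y) := hm.lintegral_prod_right'
  calc _ ≤ ∫⁻ x in E, ∫⁻ y in E, (L * d : ℝ≥0∞) ^ 2 * J (x, y) :=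
        setLIntegral_mono' hEm fun x hx => setLIntegral_mono' hEm fun y hy => hle x hx y hy
    _ = (L * d : ℝ≥0∞) ^ 2 * ∫⁻ x in E, ∫⁻ y in E, J (x, y) := by
        rw [← lintegral_const_mul _ hint]
        exact lintegral_congr fun x => lintegral_const_mul _ (hsec x)
    _ ≤ _ := mul_le_mul_right (lintegral_segment_le hE hEm hh) _

/-- Fatou's lemma in each variable; the indicators of `E n` transfer the integrals to the fixed set
`Q` and are eventually one at each of its points. -/
theorem lintegral_sub_le_of_exhaustion {Q : Set R3} (hQ : MeasurableSet Q) {E : ℕ → Set R3}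
    (hE : ∀ n, MeasurableSet (E n)) (hQE : ∀ x ∈ Q, ∀ᶠ n in atTop, x ∈ E n) {v : R3 → ℝ}
    {w : ℕ → R3 → ℝ} (hw : ∀ n, Measurable (w n))
    (hlim : ∀ᵐ x ∂(volume.restrict Q), Tendsto (fun n => w n x) atTop (𝓝 (v x))) {R : ℝ≥0∞}
    (hR : ∀ n, ∫⁻ x in E n, ∫⁻ y in E n, ‖w n y - w n x‖ₑ ^ 2 ≤ R) :
    ∫⁻ x in Q, ∫⁻ y in Q, ‖v y - v x‖ₑ ^ 2 ≤ R := by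
  set χ : ℕ → R3 → ℝ≥0∞ := fun n => (E n).indicator 1 with hχ
  have hχm : ∀ n, Measurable (χ n) := fun n => measurable_one.indicator (hE n)
  have hχ1 : ∀ x ∈ Q, ∀ᶠ n in atTop, χ n x = 1 := fun x hx => by
    filter_upwards [hQE x hx] with n hn
    exact indicator_of_mem hn _
  have hmul : ∀ n (f : R3 → ℝ≥0∞), ∫⁻ x in Q, χ n x * f x ≤ ∫⁻ x in E n, f x := by
    intro n f
    rw [← lintegral_indicator (hE n)]
    refine (setLIntegral_le_lintegral _ _).trans (le_of_eq (lintegral_congr fun x => ?_))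
    by_cases hx : x ∈ E n <;> simp [hχ, hx]
  set F : ℕ → R3 → R3 → ℝ≥0∞ := fun n x y => χ n x * (χ n y * ‖w n y - w n x‖ₑ ^ 2) with hF
  have hFm : ∀ n, Measurable fun p : R3 × R3 => F n p.1 p.2 := fun n =>
    ((hχm n).comp measurable_fst).mul (((hχm n).comp measurable_snd).mul
      ((((hw n).comp measurable_snd).sub ((hw n).comp measurable_fst)).enorm.pow_const 2))
  have hFR : ∀ n, ∫⁻ x in Q, ∫⁻ y in Q, F n x y ≤ R := by
    intro n
    calc _ ≤ ∫⁻ x in Q, χ n x * ∫⁻ y in E n, ‖w n y - w n x‖ₑ ^ 2 := by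
          refine lintegral_mono fun x => ?_
          have hm : Measurable fun y => χ n y * ‖w n y - w n x‖ₑ ^ 2 :=
            (hχm n).mul (((hw n).sub measurable_const).enorm.pow_const 2)
          simp only [hF]
          rw [lintegral_const_mul _ hm]
          exact mul_le_mul_right (hmul n _) _
      _ ≤ ∫⁻ x in E n, ∫⁻ y in E n, ‖w n y - w n x‖ₑ ^ 2 := hmul n _
      _ ≤ R := hR n
  calc _ ≤ ∫⁻ x in Q, ∫⁻ y in Q, liminf (fun n => F n x y) atTop := by
        refine lintegral_mono_ae ?_
        filter_upwards [hlim, ae_restrict_mem hQ] with x hx hxQ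
        refine lintegral_mono_ae ?_
        filter_upwards [hlim, ae_restrict_mem hQ] with y hy hyQ
        refine (Tendsto.liminf_eq ?_).ge
        have h1 : Tendsto (fun n => ‖w n y - w n x‖ₑ ^ 2) atTop (𝓝 (‖v y - v x‖ₑ ^ 2)) :=
          ENNReal.Tendsto.pow ((hy.sub hx).enorm)
        refine h1.congr' ?_
        filter_upwards [hχ1 x hxQ, hχ1 y hyQ] with n h2 h3
        simp only [hF, h2, h3, one_mul]
    _ ≤ ∫⁻ x in Q, liminf (fun n => ∫⁻ y in Q, F n x y) atTop :=
        lintegral_mono fun x => lintegral_liminf_le fun n => (hFm n).comp measurable_prodMk_left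
    _ ≤ liminf (fun n => ∫⁻ x in Q, ∫⁻ y in Q, F n x y) atTop :=
        lintegral_liminf_le fun n => (hFm n).lintegral_prod_right'
    _ ≤ R := by
        refine liminf_le_of_le (by isBoundedDefault) fun b hb => ?_
        obtain ⟨n, hn⟩ := hb.exists
        exact hn.trans (hFR n)

section Chart

variable {Ω Q : Set R3} {Ψ φ : R3 → R3} {L L' d : ℝ≥0} {u : L2 Ω} {g : L2Vec Ω}

theorem lintegral_fderiv_mollify_le (hΩ : MeasurableSet Ω) (hΨ : LipschitzWith L Ψ)
    (hφ : LipschitzWith L' φ) {E : Set R3} (hE : MeasurableSet E) (hinv : LeftInvOn φ Ψ E)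
    {G : Set R3} (hG : MeasurableSet G) (hGΩ : G ⊆ Ω) (hu : IsWeakGradient Ω u g)
    (ρ : ContDiffBump (0 : R3)) (hρ : ∀ x ∈ E, closedBall (Ψ x) ρ.rOut ⊆ G) :
    ∫⁻ z in E, ‖fderiv ℝ (mollify Ω u ρ) (Ψ z)‖ₑ ^ 2 ≤
      (L' : ℝ≥0∞) ^ 3 * ∫⁻ y in G, ‖g y‖ₑ ^ 2 := by
  have hg : Measurable fun y => ‖g y‖ₑ ^ 2 :=
    ((Lp.stronglyMeasurable g).measurable.enorm).pow_const 2
  have hm : Measurable fun x => ∫⁻ y in G, ‖ρ.normed volume (x - y)‖ₑ * ‖g y‖ₑ ^ 2 :=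
    Measurable.lintegral_prod_right' (f := fun p : R3 × R3 =>
      ‖ρ.normed volume (p.1 - p.2)‖ₑ * ‖g p.2‖ₑ ^ 2)
      ((ρ.continuous_normed.comp (continuous_fst.sub continuous_snd)).enorm.measurable.mul
        (hg.comp measurable_snd))
  calc _ ≤ ∫⁻ z in E, ∫⁻ y in G, ‖ρ.normed volume (Ψ z - y)‖ₑ * ‖g y‖ₑ ^ 2 :=
        setLIntegral_mono' hE fun z hz => enorm_fderiv_mollify_sq_le hΩ hG hGΩ hu ρ (hρ z hz)
    _ ≤ (L' : ℝ≥0∞) ^ 3 *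
        ∫⁻ x in Ψ '' E, ∫⁻ y in G, ‖ρ.normed volume (x - y)‖ₑ * ‖g y‖ₑ ^ 2 :=
        setLIntegral_comp_le hΨ.continuous hφ hinv hm
    _ ≤ _ := mul_le_mul_right
        ((setLIntegral_le_lintegral _ _).trans (lintegral_mollifier hg.aemeasurable ρ).le) _

/-- The Poincaré inequality on a bi-Lipschitz image of a convex set, in the form of a double
integral. -/
theorem lintegral_sub_comp_le_of_isWeakGradient (hΩ : MeasurableSet Ω) (hΨ : LipschitzWith L Ψ)
    (hφ : LipschitzWith L' φ) (hinv : LeftInvOn φ Ψ Q) (hQ : IsOpen Q) (hQc : Convex ℝ Q)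
    (hd : ∀ x ∈ Q, ∀ y ∈ Q, dist x y ≤ d) (hG : IsOpen (Ψ '' Q)) (hGΩ : Ψ '' Q ⊆ Ω)
    (hu : IsWeakGradient Ω u g) :
    ∫⁻ x in Q, ∫⁻ y in Q, ‖u (Ψ y) - u (Ψ x)‖ₑ ^ 2 ≤
      (L * d) ^ 2 * (8 * volume Q * (L' ^ 3 * ∫⁻ y in Ψ '' Q, ‖g y‖ₑ ^ 2)) := by
  set RHS : ℝ≥0∞ := (L * d) ^ 2 * (8 * volume Q * (L' ^ 3 * ∫⁻ y in Ψ '' Q, ‖g y‖ₑ ^ 2)) with hR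
  have hpos : ∀ n : ℕ, 0 < 1 / ((n : ℝ) + 1) := fun n => Nat.one_div_pos_of_nat
  set E : ℕ → Set R3 := fun n => erosion (1 / ((n : ℝ) + 1)) Q with hE
  have hEQ : ∀ n, E n ⊆ Q := fun n => erosion_subset (hpos n) Q
  have hQb : Bornology.IsBounded Q := Metric.isBounded_iff.2 ⟨d, fun x hx y hy => hd x hx y hy⟩
  have hEc : ∀ n, IsCompact (E n) := fun n =>
    Metric.isCompact_of_isClosed_isBounded (isClosed_erosion _ _) (hQb.subset (hEQ n))
  have hEm : ∀ n, MeasurableSet (E n) := fun n => (hEc n).measurableSet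
  -- The compact image of `E n` has positive distance to the complement of the open set `Ψ '' Q`,
  -- which leaves room for mollification.
  have hr : ∀ n, ∃ r > 0, ∀ x ∈ E n, closedBall (Ψ x) r ⊆ Ψ '' Q := by
    intro n
    obtain ⟨r, hr, h⟩ := ((hEc n).image hΨ.continuous).exists_cthickening_subset_open hG
      (image_mono (hEQ n))
    exact ⟨r, hr, fun x hx =>
      (closedBall_subset_cthickening (mem_image_of_mem _ hx) r).trans h⟩
  choose r hr0 hr using hr
  set ρ : ℕ → ContDiffBump (0 : R3) := fun n =>
    { rIn := min (r n) (1 / ((n : ℝ) + 1)) / 2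
      rOut := min (r n) (1 / ((n : ℝ) + 1))
      rIn_pos := half_pos (lt_min (hr0 n) (hpos n))
      rIn_lt_rOut := half_lt_self (lt_min (hr0 n) (hpos n)) } with hρ
  have hρ0 : Tendsto (fun n => (ρ n).rOut) atTop (𝓝 0) :=
    squeeze_zero (fun n => (ρ n).rOut_pos.le) (fun n => min_le_right _ _)
      tendsto_one_div_add_atTop_nhds_zero_nat
  set w : ℕ → R3 → ℝ := fun n => mollify Ω u (ρ n) with hw
  have hwc : ∀ n, ContDiff ℝ 1 (w n) := fun n => contDiff_mollify hΩ u (ρ n)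
  have hwm : ∀ n, Measurable fun x => w n (Ψ x) := fun n =>
    ((hwc n).continuous.comp hΨ.continuous).measurable
  have hlim : ∀ᵐ x ∂(volume.restrict Q), Tendsto (fun n => w n (Ψ x)) atTop (𝓝 (u (Ψ x))) := by
    have h1 : ∀ᵐ x, Tendsto (fun n => w n x) atTop (𝓝 (Ω.indicator u x)) :=
      ae_tendsto_mollify hΩ u hρ0 fun n => by simp only [hρ]; linarith
    rw [ae_restrict_iff' hQ.measurableSet]
    rw [ae_iff] at h1 ⊢
    -- The bad points of `Q` lie in the image under the Lipschitz map `φ` of the null set where the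
    -- mollifications fail to converge.
    refine measure_mono_null ?_ (nonpos_iff_eq_zero.1
      ((volume_image_le hφ _).trans_eq (by rw [h1, mul_zero])))
    intro x hx
    rw [mem_ofPred_eq, Classical.not_imp] at hx
    refine ⟨Ψ x, ?_, hinv hx.1⟩
    rw [mem_ofPred_eq, indicator_of_mem (hGΩ (mem_image_of_mem _ hx.1))]
    exact hx.2
  refine lintegral_sub_le_of_exhaustion hQ.measurableSet hEm
    (fun x hx => eventually_mem_erosion hQ hx) hwm hlim fun n => ?_
  refine (lintegral_sub_comp_le (hwc n) hΨ (convex_erosion hQc) (hEm n)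
    fun x hx y hy => hd x (hEQ n hx) y (hEQ n hy)).trans ?_
  rw [hR]
  gcongr
  · exact hEQ n
  · refine lintegral_fderiv_mollify_le hΩ hΨ hφ (hEm n) (hinv.mono (hEQ n))
      hG.measurableSet hGΩ hu (ρ n) fun x hx => ?_
    exact (closedBall_subset_closedBall (min_le_left _ _)).trans (hr n x hx)

end Chart

/-! ### The Poincaré inequality with the mean value -/

theorem ennreal_add_sq_le (a b : ℝ≥0∞) : (a + b) ^ 2 ≤ 2 * (a ^ 2 + b ^ 2) := by
  have := ENNReal.rpow_add_le_mul_rpow_add_rpow a b (p := 2) (by norm_num)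
  norm_num at this
  exact this

/-- The `L²` norm is controlled by the mean and the mean oscillation. -/
theorem lintegral_enorm_sq_le_mean {α : Type*} [MeasurableSpace α] (μ : Measure α)
    [IsFiniteMeasure μ] {f : α → ℝ} (hf : Measurable f) (hfi : Integrable f μ) :
    μ univ * ∫⁻ x, ‖f x‖ₑ ^ 2 ∂μ ≤
      2 * (‖∫ x, f x ∂μ‖ₑ ^ 2 + ∫⁻ x, ∫⁻ y, ‖f y - f x‖ₑ ^ 2 ∂μ ∂μ) := by
  set V := μ univ with hV
  rcases eq_or_ne V 0 with h0 | h0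
  · rw [h0, zero_mul]
    exact zero_le
  have hVt : V ≠ ⊤ := measure_ne_top μ univ
  set B := ∫ x, f x ∂μ with hB
  have hpt : ∀ x, V ^ 2 * ‖f x‖ₑ ^ 2 ≤
      2 * (‖B‖ₑ ^ 2 + V * ∫⁻ y, ‖f y - f x‖ₑ ^ 2 ∂μ) := by
    intro x
    have hm : AEMeasurable (fun y => ‖f y - f x‖ₑ) μ := (hf.sub measurable_const).enorm.aemeasurable
    -- Averaging $f(x)=f(y)-(f(y)-f(x))$ over $y$ separates the mean from the oscillation.
    have e : (V.toReal * f x) = B - ∫ y, (f y - f x) ∂μ := by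
      rw [integral_sub hfi (integrable_const _), integral_const, smul_eq_mul, hB, hV, measureReal_def]
      ring
    have h1 : V * ‖f x‖ₑ ≤ ‖B‖ₑ + ∫⁻ y, ‖f y - f x‖ₑ ∂μ := by
      calc V * ‖f x‖ₑ = ‖V.toReal * f x‖ₑ := by
            rw [enorm_mul, Real.enorm_of_nonneg ENNReal.toReal_nonneg, ENNReal.ofReal_toReal hVt]
        _ ≤ _ := by
            rw [e]
            exact (enorm_sub_le).trans (add_le_add le_rfl (enorm_integral_le_lintegral_enorm _))
    calc V ^ 2 * ‖f x‖ₑ ^ 2 = (V * ‖f x‖ₑ) ^ 2 := (mul_pow _ _ _).symm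
      _ ≤ (‖B‖ₑ + ∫⁻ y, ‖f y - f x‖ₑ ∂μ) ^ 2 := by gcongr
      _ ≤ _ := ennreal_add_sq_le _ _
      _ ≤ _ := by
          gcongr
          exact sq_lintegral_le μ hm
  have hmi : Measurable fun x => ∫⁻ y, ‖f y - f x‖ₑ ^ 2 ∂μ :=
    Measurable.lintegral_prod_right' (f := fun p : α × α => ‖f p.2 - f p.1‖ₑ ^ 2) (by fun_prop)
  have hint : V ^ 2 * ∫⁻ x, ‖f x‖ₑ ^ 2 ∂μ ≤
      V * (2 * (‖B‖ₑ ^ 2 + ∫⁻ x, ∫⁻ y, ‖f y - f x‖ₑ ^ 2 ∂μ ∂μ)) := by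
    rw [← lintegral_const_mul _ (hf.enorm.pow_const 2)]
    refine (lintegral_mono hpt).trans (le_of_eq ?_)
    have hm2 : Measurable fun x => ‖B‖ₑ ^ 2 + V * ∫⁻ y, ‖f y - f x‖ₑ ^ 2 ∂μ :=
      (hmi.const_mul V).const_add _
    rw [lintegral_const_mul _ hm2, lintegral_add_left measurable_const, lintegral_const,
      lintegral_const_mul _ hmi]
    ring
  rw [pow_two, mul_assoc] at hint
  exact (ENNReal.mul_le_mul_iff_right h0 hVt).1 hint

theorem lintegral_lintegral_image_le {Q : Set R3} {Ψ : R3 → R3} {L : ℝ≥0} (hΨ : LipschitzWith L Ψ)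
    {F : R3 → R3 → ℝ≥0∞} (hF : Measurable fun p : R3 × R3 => F p.1 p.2) :
    ∫⁻ x in Ψ '' Q, ∫⁻ y in Ψ '' Q, F x y ≤
      (L : ℝ≥0∞) ^ 3 * ((L : ℝ≥0∞) ^ 3 * ∫⁻ x in Q, ∫⁻ y in Q, F (Ψ x) (Ψ y)) := by
  have hΨm := hΨ.continuous.measurable
  have h1 : Measurable fun x => ∫⁻ y in Ψ '' Q, F x y := hF.lintegral_prod_right'
  have h2 : Measurable fun p : R3 × R3 => F (Ψ p.1) (Ψ p.2) :=
    hF.comp (f := fun p : R3 × R3 => (Ψ p.1, Ψ p.2))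
      ((hΨm.comp measurable_fst).prodMk (hΨm.comp measurable_snd))
  have h3 : Measurable fun x => ∫⁻ y in Q, F (Ψ x) (Ψ y) := h2.lintegral_prod_right'
  refine (setLIntegral_image_le hΨ h1).trans (mul_le_mul_right ?_ _)
  rw [← lintegral_const_mul _ h3]
  exact lintegral_mono fun x => setLIntegral_image_le hΨ (h := F (Ψ x))
    (hF.comp measurable_prodMk_left)

section Chart

variable {Ω Q : Set R3} {Ψ φ : R3 → R3} {L L' d : ℝ≥0} {u : L2 Ω} {g : L2Vec Ω}

/-- The Poincaré inequality on a bi-Lipschitz image of a convex set. -/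
theorem volume_mul_setLIntegral_le (hΩ : MeasurableSet Ω) (hΨ : LipschitzWith L Ψ)
    (hφ : LipschitzWith L' φ) (hinv : LeftInvOn φ Ψ Q) (hQ : IsOpen Q) (hQc : Convex ℝ Q)
    (hd : ∀ x ∈ Q, ∀ y ∈ Q, dist x y ≤ d) (hG : IsOpen (Ψ '' Q)) (hGΩ : Ψ '' Q ⊆ Ω)
    (hGv : volume (Ψ '' Q) ≠ ⊤) (hu : IsWeakGradient Ω u g) :
    volume (Ψ '' Q) * ∫⁻ y in Ψ '' Q, ‖u y‖ₑ ^ 2 ≤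
      2 * ‖∫ y in Ψ '' Q, u y‖ₑ ^ 2 +
        volume (Ψ '' Q) * ((16 * L ^ 8 * L' ^ 6) * d ^ 2 * ∫⁻ y in Ψ '' Q, ‖g y‖ₑ ^ 2) := by
  have hum : Measurable u := (Lp.stronglyMeasurable u).measurable
  set μ := volume.restrict (Ψ '' Q) with hμ
  have : IsFiniteMeasure μ := ⟨by rw [hμ, Measure.restrict_apply_univ]; exact hGv.lt_top⟩
  have hui : Integrable u μ := ((Lp.memLp u).mono_measure
    (Measure.restrict_mono hGΩ le_rfl)).integrable (by norm_num)
  have h1 := lintegral_enorm_sq_le_mean μ hum hui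
  rw [hμ, Measure.restrict_apply_univ] at h1
  set I := ∫⁻ y in Ψ '' Q, ‖g y‖ₑ ^ 2 with hI
  have hQV : volume Q ≤ (L' : ℝ≥0∞) ^ 3 * volume (Ψ '' Q) := by
    refine (measure_mono fun x hx => ?_).trans (volume_image_le hφ (Ψ '' Q))
    exact ⟨Ψ x, mem_image_of_mem _ hx, hinv hx⟩
  have hm1 : Measurable fun p : R3 × R3 => ‖u p.2 - u p.1‖ₑ ^ 2 := by fun_prop
  have h2 := lintegral_lintegral_image_le (Q := Q) hΨ (F := fun x y => ‖u y - u x‖ₑ ^ 2) hm1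
  have h3 := lintegral_sub_comp_le_of_isWeakGradient hΩ hΨ hφ hinv hQ hQc hd hG hGΩ hu
  set V := volume (Ψ '' Q)
  set B := ‖∫ y in Ψ '' Q, u y‖ₑ ^ 2
  have h4 : ((L : ℝ≥0∞) * d) ^ 2 * (8 * volume Q * ((L' : ℝ≥0∞) ^ 3 * I)) ≤
      (L * d) ^ 2 * (8 * ((L' : ℝ≥0∞) ^ 3 * V) * (L' ^ 3 * I)) := by gcongr
  have h5 := h2.trans (mul_le_mul_right (mul_le_mul_right (h3.trans h4) _) _)
  -- Origin of the constant: $16=2\cdot 8$; $L^8$ is $L^6$ from two changes of variables and $L^2$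
  -- from the segments; $L'^6$ is $L'^3$ from the gradient integral and $L'^3$ from comparing the
  -- volume of `Q` with that of its image.
  refine h1.trans ((mul_le_mul_right (add_le_add le_rfl h5) 2).trans (le_of_eq ?_))
  generalize (L : ℝ≥0∞) = l
  generalize (L' : ℝ≥0∞) = l'
  generalize (d : ℝ≥0∞) = e
  ring

end Chart

/-! ### A compactness criterion with finitely many functionals -/

theorem lp_enorm_sq_eq_lintegral {α E : Type*} [MeasurableSpace α] {μ : Measure α}
    [NormedAddCommGroup E] (f : Lp E 2 μ) : ‖f‖ₑ ^ 2 = ∫⁻ x, ‖f x‖ₑ ^ 2 ∂μ := by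
  have := eLpNorm_nnreal_pow_eq_lintegral (μ := μ) (f := f) (p := 2) (by norm_num)
  rw [Lp.enorm_def]
  simpa using this

/-- The integral over a subset of `Ω` as a functional on `H¹(Ω)`. -/
noncomputable def setIntegralCLM (Ω G : Set R3) (hG : MeasurableSet G)
    (h : (volume.restrict Ω) G ≠ ⊤) : H1 Ω →L[ℝ] ℝ :=
  (innerSL ℝ (indicatorConstLp 2 hG h (1 : ℝ))).comp (toL2 Ω)

theorem setIntegralCLM_apply {Ω G : Set R3} (hG : MeasurableSet G) (hGΩ : G ⊆ Ω)
    (h : (volume.restrict Ω) G ≠ ⊤) (p : H1 Ω) :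
    setIntegralCLM Ω G hG h p = ∫ y in G, toL2 Ω p y := by
  rw [setIntegralCLM, ContinuousLinearMap.comp_apply, innerSL_apply_apply,
    L2.inner_indicatorConstLp_one, Measure.restrict_restrict hG, inter_eq_left.2 hGΩ]

/-- The restriction `H¹(Ω) → L²(G)` is, up to an arbitrarily small error, controlled by finitely many
functionals. -/
def HasPrecompactRestriction (Ω G : Set R3) : Prop :=
  ∀ ε : ℝ≥0, 0 < ε → ∃ (ι : Type) (_ : Fintype ι) (A : ι → (H1 Ω →L[ℝ] ℝ)), ∀ p : H1 Ω,
    ∫⁻ y in G, ‖toL2 Ω p y‖ₑ ^ 2 ≤ ∑ i, ‖A i p‖ₑ ^ 2 + ε * ‖p‖ₑ ^ 2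

theorem HasPrecompactRestriction.mono {Ω G G' : Set R3} (h : HasPrecompactRestriction Ω G')
    (hG : G ⊆ G') : HasPrecompactRestriction Ω G := by
  intro ε hε
  obtain ⟨ι, hι, A, hA⟩ := h ε hε
  exact ⟨ι, hι, A, fun p => (lintegral_mono_set hG).trans (hA p)⟩

theorem HasPrecompactRestriction.union {Ω G G' : Set R3} (h : HasPrecompactRestriction Ω G)
    (h' : HasPrecompactRestriction Ω G') : HasPrecompactRestriction Ω (G ∪ G') := by
  intro ε hε
  obtain ⟨ι, hι, A, hA⟩ := h (ε / 2) (half_pos hε)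
  obtain ⟨ι', hι', A', hA'⟩ := h' (ε / 2) (half_pos hε)
  refine ⟨ι ⊕ ι', inferInstance, Sum.elim A A', fun p => (lintegral_union_le _ _ _).trans
    ((add_le_add (hA p) (hA' p)).trans (le_of_eq ?_))⟩
  have e : ((ε / 2 : ℝ≥0) : ℝ≥0∞) + ((ε / 2 : ℝ≥0) : ℝ≥0∞) = ε := by
    rw [← ENNReal.coe_add, add_halves]
  rw [Fintype.sum_sum_type]
  simp only [Sum.elim_inl, Sum.elim_inr]
  rw [add_add_add_comm, ← add_mul, e]

/-- The functionals map the unit ball to a bounded set in finite dimension, which has a finite net.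
Points of the ball assigned to the same net point have close images under `T`. -/
theorem isCompactOperator_of_le {E F : Type*} [NormedAddCommGroup E] [NormedSpace ℝ E]
    [NormedAddCommGroup F] [NormedSpace ℝ F] [CompleteSpace F] (T : E →L[ℝ] F)
    (h : ∀ ε : ℝ, 0 < ε → ∃ (ι : Type) (_ : Fintype ι) (A : ι → (E →L[ℝ] ℝ)), ∀ p : E,
      ‖T p‖ ^ 2 ≤ ∑ i, ‖A i p‖ ^ 2 + ε * ‖p‖ ^ 2) : IsCompactOperator T := by
  refine (isCompactOperator_iff_isCompact_closure_image_closedBall (T : E →ₗ[ℝ] F) one_pos).2 ?_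
  refine TotallyBounded.isCompact_of_isClosed ?_ isClosed_closure
  refine TotallyBounded.closure (Metric.totallyBounded_of_finite_discretization fun ε hε => ?_)
  -- Differences in the unit ball have squared norm at most $4$, so this term contributes
  -- $\varepsilon^2/4$; the choice of `δ` makes the functionals contribute at most $\varepsilon^2/4$
  -- as well.
  obtain ⟨ι, hι, A, hA⟩ := h (ε ^ 2 / 16) (by positivity)
  set N : ℝ := (Fintype.card ι : ℝ) with hN
  set δ := ε / (4 * (N + 1)) with hδ
  have hδ0 : 0 < δ := by positivity
  set P : E →L[ℝ] (ι → ℝ) := ContinuousLinearMap.pi A with hP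
  have htb : TotallyBounded (P '' closedBall 0 1) :=
    ((P.lipschitz.isBounded_image isBounded_closedBall).isCompact_closure.totallyBounded).subset
      subset_closure
  obtain ⟨t, ht, htc⟩ := Metric.totallyBounded_iff.1 htb δ hδ0
  have hpre : ∀ x : ((T : E →ₗ[ℝ] F) '' closedBall 0 1 : Set F), ∃ p ∈ closedBall (0 : E) 1,
      T p = x := fun x => x.2
  choose p hp hpx using hpre
  have hcov : ∀ x, ∃ y : t, P (p x) ∈ ball (y : ι → ℝ) δ := by
    intro x
    obtain ⟨y, hy, hxy⟩ := mem_iUnion₂.1 (htc (mem_image_of_mem P (hp x)))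
    exact ⟨⟨y, hy⟩, hxy⟩
  choose y hy using hcov
  have := ht.fintype
  refine ⟨ULift t, inferInstance, fun x => ⟨y x⟩, fun x x' hxx' => ?_⟩
  have hyy : y x = y x' := congrArg ULift.down hxx'
  have h1 : ∀ i, ‖A i (p x - p x')‖ ≤ 2 * δ := by
    intro i
    have h2 : dist (P (p x)) (P (p x')) < δ + δ :=
      (dist_triangle_right _ _ (y x : ι → ℝ)).trans_lt (add_lt_add (hy x) (by rw [hyy]; exact hy x'))
    have h3 := (dist_le_pi_dist (P (p x)) (P (p x')) i).trans h2.le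
    rw [dist_eq_norm] at h3
    rw [map_sub]
    exact h3.trans_eq (two_mul δ).symm
  have h4 : ‖p x - p x'‖ ≤ 2 := by
    have := norm_sub_le (p x) (p x')
    linarith [mem_closedBall_zero_iff.1 (hp x), mem_closedBall_zero_iff.1 (hp x')]
  have h5 := hA (p x - p x')
  have h6 : ∑ i, ‖A i (p x - p x')‖ ^ 2 ≤ N * (2 * δ) ^ 2 := by
    refine (Finset.sum_le_card_nsmul _ _ ((2 * δ) ^ 2) fun i _ => ?_).trans_eq ?_
    · exact pow_le_pow_left₀ (norm_nonneg _) (h1 i) 2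
    · rw [nsmul_eq_mul, Finset.card_univ]
  have hN0 : 0 ≤ N := Nat.cast_nonneg _
  have h7 : N * (2 * δ) ^ 2 ≤ ε ^ 2 / 4 := by
    have e : δ * (N + 1) = ε / 4 := by rw [hδ]; field_simp
    have e2 : N * δ ^ 2 ≤ (δ * (N + 1)) ^ 2 := by nlinarith [sq_nonneg δ]
    rw [e] at e2
    nlinarith
  have h8 : ‖T (p x - p x')‖ ^ 2 < ε ^ 2 := by
    have : ‖p x - p x'‖ ^ 2 ≤ 4 := by nlinarith [norm_nonneg (p x - p x')]
    nlinarith [sq_pos_of_pos hε]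
  have h9 := lt_of_pow_lt_pow_left₀ 2 hε.le h8
  rw [map_sub, hpx, hpx, ← dist_eq_norm] at h9
  exact h9

theorem HasPrecompactRestriction.isCompactOperator {Ω : Set R3}
    (h : HasPrecompactRestriction Ω Ω) : IsCompactOperator (toL2 Ω) := by
  refine isCompactOperator_of_le _ fun ε hε => ?_
  obtain ⟨ι, hι, A, hA⟩ := h ε.toNNReal (Real.toNNReal_pos.2 hε)
  refine ⟨ι, hι, A, fun p => ?_⟩
  have := hA p
  rw [← lp_enorm_sq_eq_lintegral] at this
  simp only [← ofReal_norm, ← ENNReal.ofReal_pow (norm_nonneg _)] at this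
  rw [← ENNReal.ofReal_sum_of_nonneg fun i _ => by positivity,
    ← ENNReal.ofReal.eq_1, ← ENNReal.ofReal_mul hε.le,
    ← ENNReal.ofReal_add (by positivity) (by positivity),
    ENNReal.ofReal_le_ofReal_iff (by positivity)] at this
  exact this

theorem enorm_grad_le {Ω : Set R3} (p : H1 Ω) : ‖grad Ω p‖ₑ ≤ ‖p‖ₑ := by
  rw [← ofReal_norm, ← ofReal_norm]
  apply ENNReal.ofReal_le_ofReal
  have h := WithLp.prod_norm_sq_eq_of_L2 (p : WithLp 2 (L2 Ω × L2Vec Ω))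
  have h2 : ‖grad Ω p‖ ^ 2 ≤ ‖p‖ ^ 2 := by
    rw [Submodule.coe_norm, h]
    exact le_add_of_nonneg_left (sq_nonneg _)
  exact le_of_sq_le_sq h2 (norm_nonneg _)

section Chart

variable {Ω Q : Set R3} {Ψ φ : R3 → R3} {L L' d : ℝ≥0}

theorem isWeakGradient_grad {Ω : Set R3} (p : H1 Ω) : IsWeakGradient Ω (toL2 Ω p) (grad Ω p) := p.2

theorem exists_functional_setLIntegral_le (hΩ : MeasurableSet Ω) (hΨ : LipschitzWith L Ψ)
    (hφ : LipschitzWith L' φ) (hinv : LeftInvOn φ Ψ Q) (hQ : IsOpen Q) (hQc : Convex ℝ Q)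
    (hd : ∀ x ∈ Q, ∀ y ∈ Q, dist x y ≤ d) (hG : IsOpen (Ψ '' Q)) (hGΩ : Ψ '' Q ⊆ Ω) :
    ∃ A : H1 Ω →L[ℝ] ℝ, ∀ p : H1 Ω, ∫⁻ y in Ψ '' Q, ‖toL2 Ω p y‖ₑ ^ 2 ≤
      ‖A p‖ₑ ^ 2 + (16 * L ^ 8 * L' ^ 6) * d ^ 2 * ∫⁻ y in Ψ '' Q, ‖grad Ω p y‖ₑ ^ 2 := by
  set V := volume (Ψ '' Q) with hV
  have hQb : Bornology.IsBounded Q := Metric.isBounded_iff.2 ⟨d, fun x hx y hy => hd x hx y hy⟩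
  have hVt : V ≠ ⊤ := ((volume_image_le hΨ Q).trans_lt
    (ENNReal.mul_lt_top (ENNReal.pow_lt_top ENNReal.coe_lt_top) hQb.measure_lt_top)).ne
  rcases eq_or_ne V 0 with h0 | h0
  · refine ⟨0, fun p => ?_⟩
    rw [setLIntegral_measure_zero _ _ h0]
    exact zero_le
  have hVr : (volume.restrict Ω) (Ψ '' Q) ≠ ⊤ :=
    ((Measure.restrict_apply_le _ _).trans_lt hVt.lt_top).ne
  -- Normalised so that $Vc^2=2$, the factor of the squared mean; `V` can then be cancelled.
  set c : ℝ := Real.sqrt (2 / V.toReal) with hc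
  have hVpos : 0 < V.toReal := ENNReal.toReal_pos h0 hVt
  have hcV : V * ‖c‖ₑ ^ 2 = 2 := by
    rw [hc, Real.enorm_of_nonneg (Real.sqrt_nonneg _), ← ENNReal.ofReal_pow (Real.sqrt_nonneg _),
      Real.sq_sqrt (by positivity), ← ENNReal.ofReal_toReal hVt,
      ← ENNReal.ofReal_mul ENNReal.toReal_nonneg, ENNReal.toReal_ofReal hVpos.le,
      mul_div_cancel₀ _ hVpos.ne']
    simp
  refine ⟨c • setIntegralCLM Ω (Ψ '' Q) hG.measurableSet hVr, fun p => ?_⟩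
  have h := volume_mul_setLIntegral_le hΩ hΨ hφ hinv hQ hQc hd hG hGΩ hVt (isWeakGradient_grad p)
  rw [← hV] at h
  refine (ENNReal.mul_le_mul_iff_right h0 hVt).1 (h.trans (le_of_eq ?_))
  rw [_root_.smul_apply, setIntegralCLM_apply hG.measurableSet hGΩ, smul_eq_mul,
    enorm_mul, mul_pow, mul_add, ← mul_assoc V (‖c‖ₑ ^ 2), hcV]

/-! ### Subdivision of a chart by a grid -/

/-- A grid cell of side length `s`. -/
def gridCell (s : ℝ) (k : Fin 3 → ℤ) : Set R3 := {x | ∀ i, x i / s ∈ Ico (k i : ℝ) (k i + 1)}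

theorem convex_gridCell (s : ℝ) (k : Fin 3 → ℤ) : Convex ℝ (gridCell s k) := by
  intro x hx y hy a b ha hb hab i
  have := convex_Ico (𝕜 := ℝ) (k i : ℝ) (k i + 1) (hx i) (hy i) ha hb hab
  convert this using 1
  simp only [PiLp.add_apply, PiLp.smul_apply, smul_eq_mul]
  ring

theorem mem_gridCell_floor (s : ℝ) (x : R3) : x ∈ gridCell s fun i => ⌊x i / s⌋ :=
  fun i => ⟨Int.floor_le _, Int.lt_floor_add_one _⟩

theorem eq_floor_of_mem_gridCell {s : ℝ} {k : Fin 3 → ℤ} {x : R3} (hx : x ∈ gridCell s k) :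
    k = fun i => ⌊x i / s⌋ :=
  funext fun i => (Int.floor_eq_iff.2 (hx i)).symm

theorem dist_le_of_mem_gridCell {s : ℝ} (hs : 0 < s) {k : Fin 3 → ℤ} {x y : R3}
    (hx : x ∈ gridCell s k) (hy : y ∈ gridCell s k) : dist x y ≤ 2 * s := by
  have h : ∀ i, dist (x i) (y i) ^ 2 ≤ s ^ 2 := by
    intro i
    have hx := hx i
    have hy := hy i
    rw [mem_Ico, le_div_iff₀ hs, div_lt_iff₀ hs] at hx hy
    rw [Real.dist_eq, sq_abs]
    apply sq_le_sq'
    · nlinarith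
    · nlinarith
  rw [EuclideanSpace.dist_eq]
  apply Real.sqrt_le_iff.2
  refine ⟨by positivity, (Finset.sum_le_card_nsmul _ _ (s ^ 2) fun i _ => h i).trans ?_⟩
  simp
  nlinarith

theorem finite_gridCell {Q : Set R3} (hQ : Bornology.IsBounded Q) {s : ℝ} (hs : 0 < s) :
    {k | (Q ∩ gridCell s k).Nonempty}.Finite := by
  obtain ⟨r, hr⟩ := hQ.subset_closedBall 0
  refine (Set.Finite.pi' (t := fun _ : Fin 3 => Icc ⌊-r / s⌋ ⌊r / s⌋)
    fun _ => finite_Icc _ _).subset ?_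
  rintro k ⟨x, hxQ, hx⟩ i
  have h1 : |x i| ≤ r := (PiLp.norm_apply_le x i).trans (mem_closedBall_zero_iff.1 (hr hxQ))
  rw [congrFun (eq_floor_of_mem_gridCell hx) i]
  obtain ⟨h2, h3⟩ := abs_le.1 h1
  exact ⟨Int.floor_mono (by gcongr), Int.floor_mono (by gcongr)⟩

/-- Each grid piece costs one functional and an error $\varepsilon\int|\nabla u|^2$ over that piece.
As the pieces are disjoint the errors add up to at most $\varepsilon\|\nabla u\|^2$, however many
pieces there are. -/
theorem hasPrecompactRestriction_of_chart (hΩ : MeasurableSet Ω) (hΨ : LipschitzWith L Ψ)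
    (hφ : LipschitzWith L' φ) (hinv : LeftInvOn φ Ψ Q) (hQc : Convex ℝ Q)
    (hQb : Bornology.IsBounded Q) (hG : IsOpen (Ψ '' Q)) (hGΩ : Ψ '' Q ⊆ Ω) :
    HasPrecompactRestriction Ω (Ψ '' Q) := by
  intro ε hε
  set C : ℝ≥0 := 16 * L ^ 8 * L' ^ 6 with hC
  obtain ⟨d, hd0, hd⟩ : ∃ d : ℝ≥0, 0 < d ∧ C * d ^ 2 ≤ ε := by
    refine ⟨NNReal.sqrt (ε / (C + 1)), NNReal.sqrt_pos.2 (by positivity), ?_⟩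
    rw [NNReal.sq_sqrt, ← mul_div_assoc]
    refine div_le_of_le_mul₀ zero_le zero_le ?_
    rw [mul_comm ε]
    gcongr
    exact le_self_add
  -- A cell of side $s$ has diameter $\sqrt3\,s\le 2s=d$.
  set s : ℝ := d / 2 with hs
  have hs0 : 0 < s := by positivity
  -- Interiors keep the pieces convex and make them open; the lost frontiers are null, being
  -- frontiers of convex sets, and so are their Lipschitz images.
  set R : (Fin 3 → ℤ) → Set R3 := fun k => interior (Q ∩ gridCell s k) with hR
  have hRQ : ∀ k, R k ⊆ Q := fun k => interior_subset.trans inter_subset_left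
  have hRc : ∀ k, R k ⊆ gridCell s k := fun k => interior_subset.trans inter_subset_right
  have hRo : ∀ k, IsOpen (R k) := fun k => isOpen_interior
  have hRconv : ∀ k, Convex ℝ (R k) := fun k => (hQc.inter (convex_gridCell s k)).interior
  have hRd : ∀ k, ∀ x ∈ R k, ∀ y ∈ R k, dist x y ≤ d := fun k x hx y hy =>
    (dist_le_of_mem_gridCell hs0 (hRc k hx) (hRc k hy)).trans_eq (by rw [hs]; ring)
  have hRG : ∀ k, IsOpen (Ψ '' R k) := by
    intro k
    have : Ψ '' R k = Ψ '' Q ∩ φ ⁻¹' R k := by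
      ext y
      constructor
      · rintro ⟨x, hx, rfl⟩
        exact ⟨mem_image_of_mem _ (hRQ k hx), by rwa [mem_preimage, hinv (hRQ k hx)]⟩
      · rintro ⟨⟨x, hx, rfl⟩, hxR⟩
        rw [mem_preimage, hinv hx] at hxR
        exact mem_image_of_mem _ hxR
    rw [this]
    exact hG.inter ((hRo k).preimage hφ.continuous)
  have hRdisj : Pairwise (Function.onFun Disjoint fun k => Ψ '' R k) := by
    intro k k' hkk'
    rw [Function.onFun, Set.disjoint_left]
    rintro _ ⟨x, hx, rfl⟩ ⟨x', hx', hxx'⟩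
    have e : x' = x := by rw [← hinv (hRQ k hx), ← hinv (hRQ k' hx'), hxx']
    rw [e] at hx'
    exact hkk' ((eq_floor_of_mem_gridCell (hRc k hx)).trans
      (eq_floor_of_mem_gridCell (hRc k' hx')).symm)
  choose A hA using fun k => exists_functional_setLIntegral_le hΩ hΨ hφ (hinv.mono (hRQ k)) (hRo k)
    (hRconv k) (hRd k) (hRG k) ((image_mono (hRQ k)).trans hGΩ)
  set S := {k | (Q ∩ gridCell s k).Nonempty} with hS
  have hSf : S.Finite := finite_gridCell hQb hs0
  have := hSf.fintype
  refine ⟨S, this, fun k => A k, fun p => ?_⟩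
  have hnull : volume (Ψ '' ⋃ k : S, frontier (Q ∩ gridCell s k)) = 0 := by
    refine nonpos_iff_eq_zero.1 ((volume_image_le hΨ _).trans (le_of_eq ?_))
    rw [measure_iUnion_null fun k : S => (hQc.inter (convex_gridCell s k)).addHaar_frontier volume,
      mul_zero]
  have hcov : Ψ '' Q ⊆ (⋃ k : S, Ψ '' R k) ∪ Ψ '' ⋃ k : S, frontier (Q ∩ gridCell s k) := by
    rw [← image_iUnion, ← image_union]
    refine image_mono fun x hx => ?_
    have hxk : x ∈ Q ∩ gridCell s fun i => ⌊x i / s⌋ := ⟨hx, mem_gridCell_floor s x⟩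
    have hxc := subset_closure hxk
    rw [closure_eq_interior_union_frontier] at hxc
    rcases hxc with h | h
    · exact Or.inl (mem_iUnion.2 ⟨⟨_, x, hxk⟩, h⟩)
    · exact Or.inr (mem_iUnion.2 ⟨⟨_, x, hxk⟩, h⟩)
  calc ∫⁻ y in Ψ '' Q, ‖toL2 Ω p y‖ₑ ^ 2
      ≤ ∫⁻ y in (⋃ k : S, Ψ '' R k) ∪ Ψ '' ⋃ k : S, frontier (Q ∩ gridCell s k),
          ‖toL2 Ω p y‖ₑ ^ 2 := lintegral_mono_set hcov
    _ ≤ ∫⁻ y in ⋃ k : S, Ψ '' R k, ‖toL2 Ω p y‖ₑ ^ 2 := by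
        refine (lintegral_union_le _ _ _).trans_eq ?_
        rw [setLIntegral_measure_zero _ _ hnull, add_zero]
    _ ≤ ∑ k : S, ∫⁻ y in Ψ '' R k, ‖toL2 Ω p y‖ₑ ^ 2 :=
        (lintegral_iUnion_le _ _).trans_eq (tsum_fintype _)
    _ ≤ ∑ k : S, (‖A k p‖ₑ ^ 2 + ε * ∫⁻ y in Ψ '' R k, ‖grad Ω p y‖ₑ ^ 2) := by
        refine Finset.sum_le_sum fun k _ => (hA k p).trans ?_
        gcongr
        exact_mod_cast hd
    _ = ∑ k : S, ‖A k p‖ₑ ^ 2 + ε * ∫⁻ y in ⋃ k : S, Ψ '' R k, ‖grad Ω p y‖ₑ ^ 2 := by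
        rw [Finset.sum_add_distrib, ← Finset.mul_sum, lintegral_iUnion
          (fun k : S => (hRG k).measurableSet) (fun k k' h => hRdisj (Subtype.coe_injective.ne h)),
          tsum_fintype]
    _ ≤ _ := by
        gcongr
        refine (lintegral_mono_set (iUnion_subset fun k : S => (image_mono (hRQ k)).trans hGΩ)).trans ?_
        rw [← lp_enorm_sq_eq_lintegral]
        gcongr
        exact enorm_grad_le p

end Chart

/-! ### Charts and Rellich's theorem -/

theorem convex_cubeNeg : Convex ℝ cubeNeg := by
  rintro x ⟨hx, hx2⟩ y ⟨hy, hy2⟩ a b ha hb hab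
  refine ⟨fun i => ?_, ?_⟩
  · exact convex_Ioo (𝕜 := ℝ) (-1 : ℝ) 1 (hx i) (hy i) ha hb hab
  · exact convex_Iio (𝕜 := ℝ) (0 : ℝ) hx2 hy2 ha hb hab

theorem continuous_coord (i : Fin 3) : Continuous fun x : R3 => x i :=
  (EuclideanSpace.proj (𝕜 := ℝ) i : R3 →L[ℝ] ℝ).continuous

theorem isOpen_cube : IsOpen cube := by
  have : cube = ⋂ i : Fin 3, {x | -1 < x i ∧ x i < 1} := by ext; simp [cube]
  rw [this]
  exact isOpen_iInter_of_finite fun i => (isOpen_lt continuous_const (continuous_coord i)).inter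
    (isOpen_lt (continuous_coord i) continuous_const)

theorem isBounded_cube : Bornology.IsBounded cube := by
  refine (Metric.isBounded_iff_subset_closedBall 0).2 ⟨2, fun x hx => ?_⟩
  rw [mem_closedBall_zero_iff, EuclideanSpace.norm_eq]
  apply Real.sqrt_le_iff.2
  refine ⟨by norm_num, (Finset.sum_le_card_nsmul _ _ 1 fun i _ => ?_).trans ?_⟩
  · rw [Real.norm_eq_abs, sq_abs]
    nlinarith [(hx i).1, (hx i).2]
  · simp
    norm_num

/-- The maps of a Lipschitz chart extend to Lipschitz maps of the whole space. -/
theorem IsLipschitzChart.exists_extension {Ω U : Set R3} {φ : R3 → R3}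
    (h : IsLipschitzChart Ω U φ) : ∃ (Φ Ψ : R3 → R3) (L L' : ℝ≥0), LipschitzWith L Ψ ∧
      LipschitzWith L' Φ ∧ EqOn Φ φ U ∧ InvOn Ψ Φ U cube ∧ MapsTo Ψ cube U ∧
      Ψ '' cubeNeg = U ∩ Ω := by
  obtain ⟨-, hbij, ⟨L, hL⟩, ⟨ψ, hψ, L', hL'⟩, him⟩ := h
  obtain ⟨Φ, hΦ, hΦe⟩ := hL.extend_finite_dimension
  obtain ⟨Ψ, hΨ, hΨe⟩ := hL'.extend_finite_dimension
  have hmap : MapsTo Ψ cube U := by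
    intro y hy
    obtain ⟨x, hx, rfl⟩ := hbij.surjOn hy
    rwa [← hΨe hy, hψ.1 hx]
  have hinv : InvOn Ψ Φ U cube := by
    refine ⟨fun x hx => ?_, fun y hy => ?_⟩
    · rw [← hΦe hx, ← hΨe (hbij.mapsTo hx), hψ.1 hx]
    · rw [← hΦe (hmap hy), ← hΨe hy, hψ.2 hy]
  refine ⟨Φ, Ψ, _, _, hΨ, hΦ, hΦe.symm, hinv, hmap, ?_⟩
  rw [← him, image_image]
  ext x
  constructor
  · rintro ⟨y, hy, rfl⟩
    change Ψ (φ y) ∈ U ∩ Ω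
    rwa [hΦe hy.1, hinv.1 hy.1]
  · intro hx
    exact ⟨x, hx, (congrArg Ψ (hΦe hx.1)).trans (hinv.1 hx.1)⟩

theorem hasPrecompactRestriction_of_isLipschitzChart {Ω U : Set R3} (hΩ : IsOpen Ω) {φ : R3 → R3}
    (h : IsLipschitzChart Ω U φ) : HasPrecompactRestriction Ω (U ∩ Ω) := by
  obtain ⟨Φ, Ψ, L, L', hΨ, hΦ, -, hinv, -, him⟩ := h.exists_extension
  rw [← him]
  refine hasPrecompactRestriction_of_chart hΩ.measurableSet hΨ hΦ
    (hinv.2.mono (sep_subset _ _)) convex_cubeNeg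
    (isBounded_cube.subset (sep_subset _ _)) ?_ ?_
  · rw [him]
    exact h.1.inter hΩ
  · rw [him]
    exact inter_subset_right

/-- **Rellich's selection theorem** for weak Lipschitz domains. -/
theorem isCompactOperator_toL2 {Ω : Set R3} (hΩ : IsOpen Ω) (hb : Bornology.IsBounded Ω)
    (hw : IsWeakLipschitz Ω) : IsCompactOperator (toL2 Ω) := by
  obtain ⟨K, U, φ, hcov, hch⟩ := hw
  have key : HasPrecompactRestriction Ω (closure Ω ∩ Ω) := by
    -- The property is monotone and stable under finite unions, so by compactness of the closure it
    -- is enough to have it near each point: in a ball inside `Ω`, or in a boundary chart.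
    refine hb.isCompact_closure.induction_on (p := fun s => HasPrecompactRestriction Ω (s ∩ Ω))
      ?_ ?_ ?_ ?_
    · exact fun ε _ => ⟨Fin 0, inferInstance, fun _ => 0, fun p => by simp⟩
    · exact fun s t hst ht => ht.mono (inter_subset_inter_left _ hst)
    · intro s t hs ht
      rw [union_inter_distrib_right]
      exact hs.union ht
    · intro x hx
      by_cases hxΩ : x ∈ Ω
      · obtain ⟨r, hr, hball⟩ := Metric.isOpen_iff.1 hΩ x hxΩ
        refine ⟨ball x r, mem_nhdsWithin_of_mem_nhds (ball_mem_nhds x hr), ?_⟩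
        have := hasPrecompactRestriction_of_chart (Q := ball x r) hΩ.measurableSet
          LipschitzWith.id LipschitzWith.id (fun _ _ => rfl) (convex_ball x r)
          isBounded_ball (by rw [image_id]; exact isOpen_ball) (by rwa [image_id])
        rw [image_id] at this
        exact this.mono inter_subset_left
      · have hxf : x ∈ frontier Ω := ⟨hx, fun h => hxΩ (interior_subset h)⟩
        obtain ⟨k, hk⟩ := mem_iUnion.1 (hcov hxf)
        exact ⟨U k, mem_nhdsWithin_of_mem_nhds ((hch k).1.mem_nhds hk),
          hasPrecompactRestriction_of_isLipschitzChart hΩ (hch k)⟩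
  rw [inter_eq_right.2 subset_closure] at key
  exact key.isCompactOperator

/-! ### Functions with vanishing gradient -/

theorem exists_ae_eq_const_ball {Ω : Set R3} (hΩ : IsOpen Ω) {p : H1 Ω} (hp : grad Ω p = 0) {x : R3}
    {r : ℝ} (hr : 0 < r) (hx : ball x r ⊆ Ω) :
    ∃ c : ℝ, ∀ᵐ y ∂(volume.restrict (ball x r)), toL2 Ω p y = c := by
  have hm : Measurable (toL2 Ω p) := (Lp.stronglyMeasurable _).measurable
  have hm2 : Measurable fun q : R3 × R3 => ‖toL2 Ω p q.2 - toL2 Ω p q.1‖ₑ ^ 2 := by fun_prop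
  have h := lintegral_sub_comp_le_of_isWeakGradient (Q := ball x r) (d := (2 * r).toNNReal)
    hΩ.measurableSet LipschitzWith.id LipschitzWith.id (fun _ _ => rfl) isOpen_ball
    (convex_ball x r) (fun y hy z hz => ?_) (by rw [image_id]; exact isOpen_ball)
    (by rwa [image_id]) (isWeakGradient_grad p)
  · have h0 : ∫⁻ y in ball x r, ‖grad Ω p y‖ₑ ^ 2 = 0 := by
      refine nonpos_iff_eq_zero.1 ((lintegral_mono_set hx).trans (le_of_eq ?_))
      rw [← lp_enorm_sq_eq_lintegral, hp]
      simp
    have hm3 : Measurable fun y => ∫⁻ z in ball x r, ‖toL2 Ω p z - toL2 Ω p y‖ₑ ^ 2 :=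
      hm2.lintegral_prod_right'
    rw [image_id, h0, mul_zero, mul_zero, mul_zero, nonpos_iff_eq_zero] at h
    replace h := (lintegral_eq_zero_iff hm3).1 h
    have : (ae (volume.restrict (ball x r))).NeBot := by
      rw [ae_neBot, Ne, Measure.restrict_eq_zero]
      exact (measure_ball_pos volume x hr).ne'
    obtain ⟨y, hy⟩ := h.exists
    refine ⟨toL2 Ω p y, ?_⟩
    have hmy : Measurable fun z => ‖toL2 Ω p z - toL2 Ω p y‖ₑ ^ 2 :=
      (hm.sub measurable_const).enorm.pow_const 2
    filter_upwards [(lintegral_eq_zero_iff hmy).1 hy] with z hz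
    simpa [sub_eq_zero] using hz
  · rw [Real.coe_toNNReal _ (by positivity)]
    have := dist_triangle_right y z x
    linarith [mem_ball.1 hy, mem_ball.1 hz]

/-- A function with vanishing weak gradient on a connected open set is constant. -/
theorem exists_ae_eq_const {Ω : Set R3} (hΩ : IsOpen Ω) (hc : IsConnected Ω) {p : H1 Ω}
    (hp : grad Ω p = 0) : ∃ c : ℝ, ∀ᵐ y ∂(volume.restrict Ω), toL2 Ω p y = c := by
  set u := toL2 Ω p
  have hloc : ∀ x ∈ Ω, ∃ c : ℝ, ∃ r > 0, ∀ᵐ y ∂(volume.restrict (ball x r)), u y = c := by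
    intro x hx
    obtain ⟨r, hr, hball⟩ := Metric.isOpen_iff.1 hΩ x hx
    obtain ⟨c, h⟩ := exists_ae_eq_const_ball hΩ hp hr hball
    exact ⟨c, r, hr, h⟩
  -- Taken for `{c}` and its complement, these open sets cover `Ω`. If both met `Ω`, connectedness
  -- would give a common point, and so a ball on which `u` equals two different constants almost
  -- everywhere.
  have hopen : ∀ S : Set ℝ,
      IsOpen {x | ∃ c ∈ S, ∃ r > 0, ∀ᵐ y ∂(volume.restrict (ball x r)), u y = c} := by
    intro S
    rw [Metric.isOpen_iff]
    rintro x ⟨c, hcS, r, hr, h⟩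
    refine ⟨r, hr, fun x' hx' => ⟨c, hcS, r - dist x' x, sub_pos.2 hx', ?_⟩⟩
    exact ae_mono (Measure.restrict_mono (ball_subset (by linarith)) le_rfl) h
  obtain ⟨x₀, hx₀⟩ := hc.nonempty
  obtain ⟨c, hx₀c⟩ := hloc x₀ hx₀
  have hall : ∀ x ∈ Ω, ∃ r > 0, ∀ᵐ y ∂(volume.restrict (ball x r)), u y = c := by
    by_contra hcon
    rw [not_forall] at hcon
    obtain ⟨x, hcon⟩ := hcon
    obtain ⟨hx, hxc⟩ := Classical.not_imp.1 hcon
    obtain ⟨z, -, ⟨a, rfl, r, hr, h⟩, b, hb, r', hr', h'⟩ :=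
      hc.isPreconnected _ _ (hopen {c}) (hopen {c}ᶜ) (fun y hy => by
        obtain ⟨a, ha⟩ := hloc y hy
        by_cases hac : a = c
        · exact Or.inl ⟨a, hac, ha⟩
        · exact Or.inr ⟨a, hac, ha⟩) ⟨x₀, hx₀, c, rfl, hx₀c⟩ ⟨x, hx, by
        obtain ⟨a, r, hr, ha⟩ := hloc x hx
        refine ⟨a, fun hac => ?_, r, hr, ha⟩
        obtain rfl : a = c := hac
        exact hxc ⟨r, hr, ha⟩⟩
    have h1 := ae_mono (Measure.restrict_mono (ball_subset_ball (min_le_left r r')) le_rfl) h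
    have h2 := ae_mono (Measure.restrict_mono (ball_subset_ball (min_le_right r r')) le_rfl) h'
    have : (ae (volume.restrict (ball z (min r r')))).NeBot := by
      rw [ae_neBot, Ne, Measure.restrict_eq_zero]
      exact (measure_ball_pos volume z (lt_min hr hr')).ne'
    obtain ⟨y, hy, hy'⟩ := (Filter.Eventually.and h1 h2).exists
    exact hb (hy'.symm.trans hy)
  refine ⟨c, ?_⟩
  rw [ae_restrict_iff' hΩ.measurableSet, ae_iff]
  refine measure_null_of_locally_null _ fun x hx => ?_
  have hxΩ : x ∈ Ω := (Classical.not_imp.1 hx).1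
  obtain ⟨r, hr, h⟩ := hall x hxΩ
  rw [ae_restrict_iff' measurableSet_ball, ae_iff] at h
  refine ⟨_, inter_mem_nhdsWithin _ (ball_mem_nhds x hr), measure_mono_null ?_ h⟩
  rintro y ⟨hy, hyb⟩
  exact fun hyc => (Classical.not_imp.1 hy).2 (hyc hyb)

/-! ### From compactness to the Poincaré inequality -/

/-- Integration against a continuous function of compact support as a functional on `L²(Ω)`. -/
noncomputable def testFunctional (Ω : Set R3) {η : R3 → ℝ} (hη : Continuous η)
    (hc : HasCompactSupport η) : L2 Ω →L[ℝ] ℝ :=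
  innerSL ℝ ((hη.memLp_of_hasCompactSupport (μ := volume.restrict Ω) (p := 2) hc).toLp η)

theorem testFunctional_apply {Ω : Set R3} {η : R3 → ℝ} (hη : Continuous η)
    (hc : HasCompactSupport η) (u : L2 Ω) :
    testFunctional Ω hη hc u = ∫ x in Ω, u x * η x := by
  rw [testFunctional, innerSL_apply_apply, L2.inner_def]
  refine integral_congr_ae ?_
  filter_upwards [(hη.memLp_of_hasCompactSupport (μ := volume.restrict Ω) (p := 2)
    hc).coeFn_toLp] with x hx
  rw [hx]
  simp

/-- Each test function imposes an equality between continuous functionals of $(u,\nabla u)$. -/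
theorem isClosed_H1 (Ω : Set R3) : IsClosed (H1 Ω : Set (WithLp 2 (L2 Ω × L2Vec Ω))) := by
  set coord : Fin 3 → L2Vec Ω →L[ℝ] L2 Ω := fun i =>
    (EuclideanSpace.proj (𝕜 := ℝ) i : R3 →L[ℝ] ℝ).compLpL 2 (volume.restrict Ω) with hcoord
  have hset : (H1 Ω : Set (WithLp 2 (L2 Ω × L2Vec Ω))) =
      ⋂ (η : R3 → ℝ) (h1 : ContDiff ℝ ∞ η) (h2 : HasCompactSupport η) (_ : tsupport η ⊆ Ω)
        (i : Fin 3), {p | testFunctional Ω (cont_partial h1 (EuclideanSpace.single i 1))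
          (h2.fderiv_apply ℝ _) p.fst = - testFunctional Ω h1.continuous h2 (coord i p.snd)} := by
    ext p
    simp only [mem_iInter, testFunctional_apply]
    refine forall_congr' fun η => forall_congr' fun h1 => forall_congr' fun h2 =>
      forall_congr' fun h3 => forall_congr' fun i => ?_
    have e : ∫ x in Ω, coord i p.snd x * η x = ∫ x in Ω, p.snd x i * η x := by
      refine integral_congr_ae ?_
      filter_upwards [ContinuousLinearMap.coeFn_compLpL (p := 2) (μ := volume.restrict Ω)
        (EuclideanSpace.proj (𝕜 := ℝ) i : R3 →L[ℝ] ℝ) p.snd] with x hx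
      rw [hcoord]
      simp only
      rw [hx]
      rfl
    rw [mem_ofPred_eq, e]
  rw [hset]
  refine isClosed_iInter fun η => isClosed_iInter fun h1 => isClosed_iInter fun h2 =>
    isClosed_iInter fun h3 => isClosed_iInter fun i => isClosed_eq ?_ ?_
  · exact (testFunctional Ω _ _).continuous.comp (WithLp.fstL 2 ℝ (L2 Ω) (L2Vec Ω)).continuous
  · exact (((testFunctional Ω _ _).continuous.comp (coord i).continuous).comp
      (WithLp.sndL 2 ℝ (L2 Ω) (L2Vec Ω)).continuous).neg

theorem norm_sq_H1 {Ω : Set R3} (p : H1 Ω) : ‖p‖ ^ 2 = ‖toL2 Ω p‖ ^ 2 + ‖grad Ω p‖ ^ 2 :=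
  WithLp.prod_norm_sq_eq_of_L2 (p : WithLp 2 (L2 Ω × L2Vec Ω))

/-- On a closed subspace that contains no function with vanishing gradient but zero, compactness of
the embedding into `L²` yields a Poincaré inequality. -/
theorem exists_poincare_constant {Ω : Set R3} (hT : IsCompactOperator (toL2 Ω))
    {V : Submodule ℝ (H1 Ω)} (hV : IsClosed (V : Set (H1 Ω)))
    (h0 : ∀ p ∈ V, grad Ω p = 0 → toL2 Ω p = 0) :
    ∃ c : ℝ, 0 < c ∧ ∀ p ∈ V, ‖toL2 Ω p‖ ≤ c * ‖grad Ω p‖ := by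
  by_contra! hcon
  have hseq : ∀ n : ℕ, ∃ p ∈ V, ‖toL2 Ω p‖ = 1 ∧ ‖grad Ω p‖ ≤ 1 / ((n : ℝ) + 1) := by
    intro n
    have hn : (0 : ℝ) < n + 1 := by positivity
    obtain ⟨q, hq, hlt⟩ := hcon (n + 1) hn
    have hpos : 0 < ‖toL2 Ω q‖ := lt_of_le_of_lt (by positivity) hlt
    refine ⟨‖toL2 Ω q‖⁻¹ • q, V.smul_mem _ hq, ?_, ?_⟩
    · rw [map_smul, norm_smul, norm_inv, norm_norm, inv_mul_cancel₀ hpos.ne']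
    · rw [map_smul, norm_smul, norm_inv, norm_norm, inv_mul_le_iff₀ hpos, mul_one_div,
        le_div_iff₀ hn]
      linarith
  choose p hpV hp1 hpg using hseq
  have hbd : ∀ n, p n ∈ closedBall (0 : H1 Ω) 2 := by
    intro n
    rw [mem_closedBall_zero_iff]
    have h1 : ‖grad Ω (p n)‖ ≤ 1 := (hpg n).trans (by
      rw [div_le_one (by positivity)]; linarith [(Nat.cast_nonneg n : (0 : ℝ) ≤ n)])
    have h2 := norm_sq_H1 (p n)
    rw [hp1] at h2
    nlinarith [norm_nonneg (grad Ω (p n)), norm_nonneg (p n)]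
  have hcomp : IsCompact (closure (toL2 Ω '' closedBall 0 2)) :=
    IsCompactOperator.isCompact_closure_image_closedBall (f := (toL2 Ω : H1 Ω →ₗ[ℝ] L2 Ω)) hT 2
  obtain ⟨f, -, σ, hσ, hlim⟩ := hcomp.tendsto_subseq (x := fun n => toL2 Ω (p n))
    fun n => subset_closure (mem_image_of_mem _ (hbd n))
  have hgrad : Tendsto (fun n => grad Ω (p (σ n))) atTop (𝓝 0) := by
    refine squeeze_zero_norm (fun n => hpg (σ n)) ?_
    exact tendsto_one_div_add_atTop_nhds_zero_nat.comp hσ.tendsto_atTop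
  -- Convergence of both components places the pair $(f,0)$ in the closed space $H^1(\Omega)$, so
  -- $f$ has weak gradient zero while keeping norm one.
  set q : WithLp 2 (L2 Ω × L2Vec Ω) := WithLp.toLp 2 (f, 0) with hq
  have hconv : Tendsto (fun n => (p (σ n) : WithLp 2 (L2 Ω × L2Vec Ω))) atTop (𝓝 q) :=
    ((WithLp.prod_continuous_toLp 2 (L2 Ω) (L2Vec Ω)).tendsto (f, 0)).comp
      (hlim.prodMk_nhds hgrad)
  have hqH : q ∈ H1 Ω := (isClosed_H1 Ω).mem_of_tendsto hconv (Eventually.of_forall fun n => (p _).2)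
  have hqV : (⟨q, hqH⟩ : H1 Ω) ∈ V :=
    hV.mem_of_tendsto (tendsto_subtype_rng.2 hconv) (Eventually.of_forall fun n => hpV _)
  have hf0 : f = 0 := h0 _ hqV rfl
  have hf1 : ‖f‖ = 1 := tendsto_nhds_unique hlim.norm (by simp [hp1])
  rw [hf0, norm_zero] at hf1
  exact zero_ne_one hf1

/-- The weak gradient of a smooth function is its gradient. -/
theorem ae_norm_fderiv_le_norm_grad {Ω : Set R3} (hΩ : IsOpen Ω) {φ : R3 → ℝ} (hφ : ContDiff ℝ ∞ φ)
    {p : H1 Ω} (hp : toL2 Ω p =ᵐ[volume.restrict Ω] φ) :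
    ∀ᵐ x ∂(volume.restrict Ω), ‖fderiv ℝ φ x‖ ≤ ‖grad Ω p x‖ := by
  have hcoord : ∀ i : Fin 3, ∀ᵐ x ∂(volume.restrict Ω),
      grad Ω p x i = fderiv ℝ φ x (EuclideanSpace.single i 1) := by
    intro i
    have hDc : Continuous fun x => fderiv ℝ φ x (EuclideanSpace.single i 1) := cont_partial hφ _
    have hgl : LocallyIntegrable (fun x => grad Ω p x i) (volume.restrict Ω) :=
      ((EuclideanSpace.proj (𝕜 := ℝ) i : R3 →L[ℝ] ℝ).comp_memLp' (Lp.memLp _)).locallyIntegrable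
        (by norm_num)
    have hloc : LocallyIntegrableOn
        (fun x => grad Ω p x i - fderiv ℝ φ x (EuclideanSpace.single i 1)) Ω volume :=
      ((locallyIntegrableOn_of_locallyIntegrable_restrict hgl).sub
        (hDc.locallyIntegrable.locallyIntegrableOn Ω))
    -- Fundamental lemma of the calculus of variations: weak and classical partial derivatives have
    -- equal integrals against every test function.
    have hae := hΩ.ae_eq_zero_of_integral_contDiff_smul_eq_zero hloc fun η h1 h2 h3 => ?_
    · rw [ae_restrict_iff' hΩ.measurableSet]
      filter_upwards [hae] with x hx hxΩ
      exact sub_eq_zero.1 (hx hxΩ)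
    · have hw := isWeakGradient_grad p η h1 h2 h3 i
      have h0 : ∀ x ∉ Ω, η x = 0 := fun x hx => image_eq_zero_of_notMem_tsupport fun h => hx (h3 h)
      have h0' : ∀ x ∉ Ω, fderiv ℝ η x (EuclideanSpace.single i 1) = 0 := fun x hx => by
        rw [image_eq_zero_of_notMem_tsupport (f := fderiv ℝ η)
          fun h => hx (h3 (tsupport_fderiv_subset ℝ (f := η) h))]
        rfl
      have e1 : ∫ x in Ω, toL2 Ω p x * fderiv ℝ η x (EuclideanSpace.single i 1) =
          ∫ x, φ x * fderiv ℝ η x (EuclideanSpace.single i 1) := by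
        have hz : ∀ x ∉ Ω, φ x * fderiv ℝ η x (EuclideanSpace.single i 1) = 0 := fun x hx => by
          rw [h0' x hx, mul_zero]
        rw [← setIntegral_eq_integral_of_forall_compl_eq_zero hz]
        refine integral_congr_ae ?_
        filter_upwards [hp] with x hx
        rw [hx]
      have hηd := cont_partial h1 (EuclideanSpace.single i 1)
      have hηdc : HasCompactSupport fun x => fderiv ℝ η x (EuclideanSpace.single i 1) :=
        h2.fderiv_apply ℝ _
      have i1 : Integrable fun x => fderiv ℝ φ x (EuclideanSpace.single i 1) * η x :=
        (hDc.mul h1.continuous).integrable_of_hasCompactSupport h2.mul_left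
      have e2 := integral_mul_fderiv_eq_neg_fderiv_mul_of_integrable (μ := (volume : Measure R3))
        (f := φ) (g := η) (v := EuclideanSpace.single i 1) i1
        ((hφ.continuous.mul hηd).integrable_of_hasCompactSupport hηdc.mul_left)
        ((hφ.continuous.mul h1.continuous).integrable_of_hasCompactSupport h2.mul_left)
        (fun x _ => hφ.differentiable (by simp) x) (fun x _ => h1.differentiable (by simp) x)
      rw [e1, e2, neg_inj] at hw
      have hz1 : ∀ x ∉ Ω, η x • (grad Ω p x i - fderiv ℝ φ x (EuclideanSpace.single i 1)) = 0 :=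
        fun x hx => by rw [h0 x hx, zero_smul]
      have hz2 : ∀ x ∉ Ω, fderiv ℝ φ x (EuclideanSpace.single i 1) * η x = 0 :=
        fun x hx => by rw [h0 x hx, mul_zero]
      rw [← setIntegral_eq_integral_of_forall_compl_eq_zero hz1]
      rw [← setIntegral_eq_integral_of_forall_compl_eq_zero hz2] at hw
      have e3 : ∀ x, η x • (grad Ω p x i - fderiv ℝ φ x (EuclideanSpace.single i 1)) =
          grad Ω p x i * η x - fderiv ℝ φ x (EuclideanSpace.single i 1) * η x := fun x => by
        rw [smul_eq_mul]; ring
      simp_rw [e3]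
      rw [integral_sub (integrable_coord_mul_cont _ h1.continuous h2 i) i1.integrableOn, hw,
        sub_self]
  filter_upwards [ae_all_iff.2 hcoord] with x hx
  refine ContinuousLinearMap.opNorm_le_bound _ (norm_nonneg _) fun v => ?_
  have hv : v = ∑ i, v i • EuclideanSpace.single i (1 : ℝ) := by
    ext j
    simp [Pi.single_apply]
  have e : fderiv ℝ φ x v = inner ℝ (grad Ω p x) v := by
    conv_lhs => rw [hv]
    rw [map_sum, PiLp.inner_apply]
    refine Finset.sum_congr rfl fun i _ => ?_
    rw [map_smul, ← hx i]
    simp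
  rw [e]
  exact norm_inner_le_norm _ _

/-! ### A Poincaré inequality near the boundary part -/

/-- The half `{x₁ < 0}` of the cube. -/
def cubeHalf : Set R3 := {x ∈ cube | x 0 < 0}

/-- The quarter `{x₁ < 0, x₃ < 0}` of the cube. -/
def cubeHalfNeg : Set R3 := {x ∈ cubeHalf | x 2 < 0}

/-- The quarter `{x₁ < 0, x₃ > 0}` of the cube. -/
def cubeHalfPos : Set R3 := {x ∈ cubeHalf | 0 < x 2}

theorem isOpen_cubeHalf : IsOpen cubeHalf :=
  isOpen_cube.inter (isOpen_lt (continuous_coord 0) continuous_const)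

theorem isOpen_cubeHalfNeg : IsOpen cubeHalfNeg :=
  isOpen_cubeHalf.inter (isOpen_lt (continuous_coord 2) continuous_const)

theorem isOpen_cubeHalfPos : IsOpen cubeHalfPos :=
  isOpen_cubeHalf.inter (isOpen_lt continuous_const (continuous_coord 2))

theorem convex_cubeHalf : Convex ℝ cubeHalf := by
  rintro x ⟨hx, hx0⟩ y ⟨hy, hy0⟩ a b ha hb hab
  refine ⟨fun i => ?_, ?_⟩
  · exact convex_Ioo (𝕜 := ℝ) (-1 : ℝ) 1 (hx i) (hy i) ha hb hab
  · exact convex_Iio (𝕜 := ℝ) (0 : ℝ) hx0 hy0 ha hb hab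

theorem nonempty_cubeHalfNeg : cubeHalfNeg.Nonempty := by
  refine ⟨!₂[-1 / 2, 0, -1 / 2], ⟨fun i => ?_, ?_⟩, ?_⟩
  · fin_cases i <;> norm_num
  · norm_num
  · change (-1 / 2 : ℝ) < 0
    norm_num

theorem nonempty_cubeHalfPos : cubeHalfPos.Nonempty := by
  refine ⟨!₂[-1 / 2, 0, 1 / 2], ⟨fun i => ?_, ?_⟩, ?_⟩
  · fin_cases i <;> norm_num
  · norm_num
  · change (0 : ℝ) < 1 / 2
    norm_num

theorem exists_diam_cube : ∃ d : ℝ≥0, ∀ x ∈ cube, ∀ y ∈ cube, dist x y ≤ d := by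
  obtain ⟨C, hC⟩ := Metric.isBounded_iff.1 isBounded_cube
  exact ⟨C.toNNReal, fun x hx y hy => (hC hx hy).trans (Real.le_coe_toNNReal C)⟩

section Patch

variable {Ψ φ : R3 → R3} {L L' d : ℝ≥0} {w : R3 → ℝ}

/-- The segment from `x` to `y` stays in the convex half cube and crosses the middle section at a
zero of $w\circ\Psi$. Stopping there uses the derivative only below the section, hence the
indicator: above it, the weak gradient on `Ω` gives no control. -/
theorem enorm_sq_le_of_vanishing (hw : ContDiff ℝ 1 w) (hΨ : LipschitzWith L Ψ)
    (h0 : ∀ z ∈ cubeZeroNeg, w (Ψ z) = 0) (hd : ∀ x ∈ cube, ∀ y ∈ cube, dist x y ≤ d)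
    {x y : R3} (hx : x ∈ cubeHalfNeg) (hy : y ∈ cubeHalfPos) :
    ‖w (Ψ x)‖ₑ ^ 2 ≤ (L * d) ^ 2 * ∫⁻ t in Ioc (0 : ℝ) 1,
      {z : R3 | z 2 < 0}.indicator (fun z => ‖fderiv ℝ w (Ψ z)‖ₑ ^ 2) (x + t • (y - x)) := by
  have hx2 : x 2 < 0 := hx.2
  have hy2 : 0 < y 2 := hy.2
  set v := y - x with hv
  have hv2 : v 2 = y 2 - x 2 := rfl
  have hv0 : 0 < v 2 := by rw [hv2]; linarith
  set T : ℝ := -x 2 / v 2 with hT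
  have hT0 : 0 < T := div_pos (by linarith) hv0
  have hT1 : T ≤ 1 := by
    rw [hT, div_le_one hv0, hv2]
    linarith
  have hTv : T * v 2 = -x 2 := div_mul_cancel₀ _ hv0.ne'
  have hcoord : ∀ t : ℝ, (x + t • v) 2 = x 2 + t * v 2 := fun t => rfl
  have hz : x + T • v ∈ cubeZeroNeg := by
    have h1 : x + T • v ∈ cubeHalf := by
      have := convex_cubeHalf hx.1 hy.1 (by linarith : 0 ≤ 1 - T) hT0.le (by ring)
      convert this using 1
      rw [hv]
      module
    exact ⟨⟨h1.1, by rw [hcoord, hTv]; ring⟩, h1.2⟩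
  have h := enorm_sub_sq_le_lintegral_segment hw hΨ x v hT0.le hT1
  rw [h0 _ hz, zero_sub, enorm_neg] at h
  refine h.trans (mul_le_mul' ?_ ?_)
  · gcongr
    have := hd y hy.1.1 x hx.1.1
    rw [dist_eq_norm, ← coe_nnnorm, NNReal.coe_le_coe] at this
    exact_mod_cast this
  -- At $t=T$ the third coordinate is zero and the indicator vanishes, so the endpoint is dropped.
  · rw [← setLIntegral_congr (Ioo_ae_eq_Ioc (a := (0 : ℝ)) (b := T))]
    refine le_trans (setLIntegral_mono' measurableSet_Ioo fun t ht => ?_)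
      (lintegral_mono_set fun t ht => ⟨ht.1, ht.2.le.trans hT1⟩)
    rw [indicator_of_mem]
    rw [mem_ofPred_eq, hcoord]
    nlinarith [ht.2]

/-- A Poincaré inequality for functions that vanish on the image of half of the middle section of
the cube. -/
theorem setLIntegral_le_of_vanishing (hw : ContDiff ℝ 1 w) (hΨ : LipschitzWith L Ψ)
    (hφ : LipschitzWith L' φ) (hinv : LeftInvOn φ Ψ cube)
    (h0 : ∀ z ∈ cubeZeroNeg, w (Ψ z) = 0) (hd : ∀ x ∈ cube, ∀ y ∈ cube, dist x y ≤ d) :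
    volume cubeHalfPos * ∫⁻ y in Ψ '' cubeHalfNeg, ‖w y‖ₑ ^ 2 ≤
      (L ^ 3 * (L * d) ^ 2 * (8 * volume cubeHalf) * L' ^ 3) *
        ∫⁻ y in Ψ '' cubeHalfNeg, ‖fderiv ℝ w y‖ₑ ^ 2 := by
  have hDm : Measurable fun z => ‖fderiv ℝ w z‖ₑ ^ 2 :=
    (hw.continuous_fderiv (by simp)).enorm.measurable.pow_const 2
  have hwm : Measurable fun z => ‖w z‖ₑ ^ 2 := hw.continuous.enorm.measurable.pow_const 2
  have hDΨ : Measurable fun z => ‖fderiv ℝ w (Ψ z)‖ₑ ^ 2 := hDm.comp hΨ.continuous.measurable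
  have hwΨ : Measurable fun z => ‖w (Ψ z)‖ₑ ^ 2 := hwm.comp hΨ.continuous.measurable
  have hlow : MeasurableSet {z : R3 | z 2 < 0} :=
    (isOpen_lt (continuous_coord 2) continuous_const).measurableSet
  set h : R3 → ℝ≥0∞ := {z : R3 | z 2 < 0}.indicator (fun z => ‖fderiv ℝ w (Ψ z)‖ₑ ^ 2) with hh
  have hhm : Measurable h := hDΨ.indicator hlow
  set J : R3 × R3 → ℝ≥0∞ := fun p => ∫⁻ t in Ioc (0 : ℝ) 1, h (p.1 + t • (p.2 - p.1)) with hJ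
  have hJm : Measurable J :=
    Measurable.lintegral_prod_right' (f := fun q : (R3 × R3) × ℝ =>
      h (q.1.1 + q.2 • (q.1.2 - q.1.1))) (hhm.comp (by fun_prop))
  have hJs : ∀ x, Measurable fun y => J (x, y) := fun x => hJm.comp measurable_prodMk_left
  have hJi : Measurable fun x => ∫⁻ y in cubeHalf, J (x, y) := hJm.lintegral_prod_right'
  -- The left side does not depend on `y`; integrating over the upper quarter yields its volume as a
  -- factor.
  have h1 : volume cubeHalfPos * ∫⁻ x in cubeHalfNeg, ‖w (Ψ x)‖ₑ ^ 2 ≤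
      (L * d) ^ 2 * ∫⁻ x in cubeHalf, ∫⁻ y in cubeHalf, J (x, y) := by
    rw [← lintegral_const_mul _ hwΨ, ← lintegral_const_mul _ hJi]
    refine le_trans (setLIntegral_mono' isOpen_cubeHalfNeg.measurableSet fun x hx => ?_)
      (lintegral_mono_set (sep_subset _ _))
    rw [← lintegral_const_mul _ (hJs x), mul_comm, ← setLIntegral_const]
    exact le_trans (setLIntegral_mono' isOpen_cubeHalfPos.measurableSet fun y hy =>
      enorm_sq_le_of_vanishing hw hΨ h0 hd hx hy) (lintegral_mono_set (sep_subset _ _))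
  have h2 : ∫⁻ x in cubeHalf, ∫⁻ y in cubeHalf, J (x, y) ≤
      8 * volume cubeHalf * ∫⁻ z in cubeHalf, h z :=
    lintegral_segment_le convex_cubeHalf isOpen_cubeHalf.measurableSet hhm
  have h3 : ∫⁻ z in cubeHalf, h z = ∫⁻ z in cubeHalfNeg, ‖fderiv ℝ w (Ψ z)‖ₑ ^ 2 := by
    rw [hh, lintegral_indicator hlow, Measure.restrict_restrict hlow, inter_comm]
    rfl
  have h4 : ∫⁻ z in cubeHalfNeg, ‖fderiv ℝ w (Ψ z)‖ₑ ^ 2 ≤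
      (L' : ℝ≥0∞) ^ 3 * ∫⁻ y in Ψ '' cubeHalfNeg, ‖fderiv ℝ w y‖ₑ ^ 2 :=
    setLIntegral_comp_le hΨ.continuous hφ (hinv.mono fun x hx => hx.1.1) hDm
  have h5 : ∫⁻ y in Ψ '' cubeHalfNeg, ‖w y‖ₑ ^ 2 ≤
      (L : ℝ≥0∞) ^ 3 * ∫⁻ x in cubeHalfNeg, ‖w (Ψ x)‖ₑ ^ 2 := setLIntegral_image_le hΨ hwm
  rw [h3] at h2
  generalize ∫⁻ y in Ψ '' cubeHalfNeg, ‖fderiv ℝ w y‖ₑ ^ 2 = D at *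
  generalize ∫⁻ x in cubeHalf, ∫⁻ y in cubeHalf, J (x, y) = I at *
  generalize (L : ℝ≥0∞) = l at *
  generalize (L' : ℝ≥0∞) = l' at *
  generalize (d : ℝ≥0∞) = e at *
  calc _ ≤ volume cubeHalfPos * (l ^ 3 * ∫⁻ x in cubeHalfNeg, ‖w (Ψ x)‖ₑ ^ 2) := by gcongr
    _ = l ^ 3 * (volume cubeHalfPos * ∫⁻ x in cubeHalfNeg, ‖w (Ψ x)‖ₑ ^ 2) := by ring
    _ ≤ l ^ 3 * ((l * e) ^ 2 * (8 * volume cubeHalf * (l' ^ 3 * D))) := by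
        refine mul_le_mul_right (h1.trans (mul_le_mul_right (h2.trans ?_) _)) _
        gcongr
    _ = _ := by ring

end Patch

/-- A chart around a point of `Γτ` is not of the first kind, and in both other kinds the image of
`Γτ` contains the half section. -/
theorem exists_patch {Ω Γτ : Set R3} (hpair : IsWeakLipschitzPair Ω Γτ) (hne : Γτ.Nonempty) :
    ∃ (U : Set R3) (φ : R3 → R3), IsLipschitzChart Ω U φ ∧ cubeZeroNeg ⊆ φ '' (U ∩ Γτ) := by
  obtain ⟨-, ⟨O, -, hO⟩, K, U, φ, hcov, hch⟩ := hpair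
  obtain ⟨x, hx⟩ := hne
  obtain ⟨k, hk⟩ := mem_iUnion.1 (hcov (hO ▸ hx : x ∈ O ∩ frontier Ω).2)
  refine ⟨U k, φ k, (hch k).1, ?_⟩
  rcases (hch k).2 with h | ⟨-, h⟩ | ⟨-, -, h⟩
  · exact absurd (h ▸ (⟨hk, hx⟩ : x ∈ U k ∩ Γτ)) (notMem_empty x)
  · rw [h]
    exact sep_subset _ _
  · rw [h]

/-- `G` and `K` are the same for all test functions, which is what allows passing to the closure. -/
theorem exists_setLIntegral_le_grad {Ω Γτ : Set R3} (hΩ : IsOpen Ω)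
    (hpair : IsWeakLipschitzPair Ω Γτ) (hne : Γτ.Nonempty) :
    ∃ (G : Set R3) (K : ℝ≥0∞), IsOpen G ∧ G.Nonempty ∧ G ⊆ Ω ∧ K ≠ ⊤ ∧
      ∀ p ∈ testFunctions Ω Γτ, ∫⁻ y in G, ‖toL2 Ω p y‖ₑ ^ 2 ≤ K * ‖grad Ω p‖ₑ ^ 2 := by
  obtain ⟨U, φ, hch, hpatch⟩ := exists_patch hpair hne
  obtain ⟨Φ, Ψ, L, L', hΨ, hΦ, hΦe, hinv, hmap, him⟩ := hch.exists_extension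
  obtain ⟨d, hd⟩ := exists_diam_cube
  have hsub : cubeHalfNeg ⊆ cubeNeg := fun x hx => ⟨hx.1.1, hx.2⟩
  have hGU : Ψ '' cubeHalfNeg ⊆ U ∩ Ω := him ▸ image_mono hsub
  have hG : Ψ '' cubeHalfNeg = U ∩ Φ ⁻¹' cubeHalfNeg := by
    ext y
    constructor
    · rintro ⟨x, hx, rfl⟩
      exact ⟨(hGU (mem_image_of_mem _ hx)).1, by rwa [mem_preimage, hinv.2 hx.1.1]⟩
    · rintro ⟨hyU, hy⟩
      exact ⟨Φ y, hy, hinv.1 hyU⟩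
  have hGo : IsOpen (Ψ '' cubeHalfNeg) := by
    rw [hG]
    exact hch.1.inter (isOpen_cubeHalfNeg.preimage hΦ.continuous)
  have hvol : volume cubeHalfPos ≠ 0 :=
    (isOpen_cubeHalfPos.measure_pos volume nonempty_cubeHalfPos).ne'
  have hfin : ∀ S ⊆ cube, volume S ≠ ⊤ := fun S hS => (isBounded_cube.subset hS).measure_lt_top.ne
  have hvolt : volume cubeHalfPos ≠ ⊤ := hfin _ fun x hx => hx.1.1
  set C : ℝ≥0∞ := L ^ 3 * (L * d) ^ 2 * (8 * volume cubeHalf) * L' ^ 3 with hC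
  have hCt : C ≠ ⊤ := by
    have : volume cubeHalf ≠ ⊤ := hfin _ (sep_subset _ _)
    finiteness
  refine ⟨Ψ '' cubeHalfNeg, (volume cubeHalfPos)⁻¹ * C, hGo, nonempty_cubeHalfNeg.image _,
    hGU.trans inter_subset_right, ENNReal.mul_ne_top (ENNReal.inv_ne_top.2 hvol) hCt, ?_⟩
  rintro p ⟨w, hw, -, ⟨δ, hδ, hdist⟩, hpw⟩
  have h0 : ∀ z ∈ cubeZeroNeg, w (Ψ z) = 0 := by
    intro z hz
    obtain ⟨y, ⟨hyU, hyΓ⟩, rfl⟩ := hpatch hz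
    rw [← hΦe hyU, hinv.1 hyU]
    by_contra hne
    have := hdist y (subset_tsupport w hne) y hyΓ
    rw [dist_self] at this
    linarith
  have h1 := setLIntegral_le_of_vanishing (hw.of_le (by simp)) hΨ hΦ hinv.2 h0 hd
  have h2 : ∫⁻ y in Ψ '' cubeHalfNeg, ‖fderiv ℝ w y‖ₑ ^ 2 ≤ ‖grad Ω p‖ₑ ^ 2 := by
    rw [lp_enorm_sq_eq_lintegral]
    refine (lintegral_mono_set (hGU.trans inter_subset_right)).trans (lintegral_mono_ae ?_)
    filter_upwards [ae_norm_fderiv_le_norm_grad hΩ hw hpw] with y hy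
    gcongr
    rw [← ofReal_norm, ← ofReal_norm]
    exact ENNReal.ofReal_le_ofReal hy
  have h3 : ∫⁻ y in Ψ '' cubeHalfNeg, ‖toL2 Ω p y‖ₑ ^ 2 = ∫⁻ y in Ψ '' cubeHalfNeg, ‖w y‖ₑ ^ 2 := by
    refine lintegral_congr_ae ?_
    filter_upwards [ae_mono (Measure.restrict_mono (hGU.trans inter_subset_right) le_rfl) hpw]
      with y hy
    rw [hy]
  rw [h3, mul_assoc, ← ENNReal.mul_le_iff_le_inv hvol hvolt]
  exact h1.trans (mul_le_mul_right h2 _)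

/-! ### Exclusion of constants and conclusion -/

/-- A function in `H¹_{Γτ}(Ω)` with vanishing gradient vanishes if `Γτ` is not empty. -/
theorem toL2_eq_zero_of_mem_H1Gamma {Ω Γτ : Set R3} (hΩ : IsOpen Ω) (hc : IsConnected Ω)
    (hpair : IsWeakLipschitzPair Ω Γτ) (hne : Γτ.Nonempty) {p : H1 Ω} (hp : p ∈ H1Gamma Ω Γτ)
    (hg : grad Ω p = 0) : toL2 Ω p = 0 := by
  obtain ⟨G, K, hG, hGne, hGΩ, hK, hle⟩ := exists_setLIntegral_le_grad hΩ hpair hne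
  obtain ⟨c, hcp⟩ := exists_ae_eq_const hΩ hc hg
  have hbound : ∀ q ∈ testFunctions Ω Γτ, ∫⁻ y in G, ‖toL2 Ω p y‖ₑ ^ 2 ≤
      2 * (1 + K) * ‖q - p‖ₑ ^ 2 := by
    intro q hq
    have hum : Measurable (toL2 Ω q) := (Lp.stronglyMeasurable _).measurable
    -- As `p` has no gradient, the gradient of an approximating `q` is that of the error `q - p`, so
    -- the estimate on `G` tends to zero along the approximation.
    have hgq : grad Ω q = grad Ω (q - p) := by rw [map_sub, hg, sub_zero]
    have hTle : ‖toL2 Ω (q - p)‖ₑ ≤ ‖q - p‖ₑ := by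
      rw [← ofReal_norm, ← ofReal_norm]
      refine ENNReal.ofReal_le_ofReal (le_of_sq_le_sq ?_ (norm_nonneg _))
      rw [norm_sq_H1]
      exact le_add_of_nonneg_right (sq_nonneg _)
    calc ∫⁻ y in G, ‖toL2 Ω p y‖ₑ ^ 2
        ≤ ∫⁻ y in G, 2 * (‖toL2 Ω q y‖ₑ ^ 2 + ‖toL2 Ω (q - p) y‖ₑ ^ 2) := by
          refine lintegral_mono_ae ?_
          have hsub := Lp.coeFn_sub (toL2 Ω q) (toL2 Ω p)
          rw [← map_sub] at hsub
          filter_upwards [ae_mono (Measure.restrict_mono hGΩ le_rfl) hsub] with y hy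
          have e : toL2 Ω p y = toL2 Ω q y - toL2 Ω (q - p) y := by rw [hy, Pi.sub_apply]; ring
          rw [e]
          refine le_trans ?_ (ennreal_add_sq_le _ _)
          gcongr
          exact enorm_sub_le
      _ = 2 * ((∫⁻ y in G, ‖toL2 Ω q y‖ₑ ^ 2) + ∫⁻ y in G, ‖toL2 Ω (q - p) y‖ₑ ^ 2) := by
          rw [lintegral_const_mul' _ _ (by simp), lintegral_add_left (hum.enorm.pow_const 2)]
      _ ≤ 2 * (K * ‖q - p‖ₑ ^ 2 + ‖q - p‖ₑ ^ 2) := by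
          gcongr
          · refine (hle q hq).trans ?_
            rw [hgq]
            gcongr
            exact enorm_grad_le _
          · refine (lintegral_mono_set hGΩ).trans ?_
            rw [← lp_enorm_sq_eq_lintegral]
            gcongr
      _ = _ := by ring
  have hzero : ∫⁻ y in G, ‖toL2 Ω p y‖ₑ ^ 2 = 0 := by
    obtain ⟨q, hq, hlim⟩ := mem_closure_iff_seq_limit.1 (show p ∈ closure _ from hp)
    have hlim' : Tendsto (fun n => 2 * (1 + K) * ‖q n - p‖ₑ ^ 2) atTop (𝓝 0) := by
      have h1 : Tendsto (fun n => ‖q n - p‖ₑ) atTop (𝓝 0) := by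
        have := (hlim.sub_const p).enorm
        rwa [sub_self, ← ofReal_norm (0 : H1 Ω), norm_zero, ENNReal.ofReal_zero] at this
      have h2 := ENNReal.Tendsto.const_mul (a := 2 * (1 + K)) (ENNReal.Tendsto.pow (n := 2) h1)
        (Or.inr (by finiteness))
      simpa using h2
    exact nonpos_iff_eq_zero.1 (ge_of_tendsto' hlim' fun n => hbound _ (hq n))
  have hconst : ∫⁻ y in G, ‖toL2 Ω p y‖ₑ ^ 2 = ‖c‖ₑ ^ 2 * volume G := by
    rw [← setLIntegral_const]
    refine lintegral_congr_ae ?_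
    filter_upwards [ae_mono (Measure.restrict_mono hGΩ le_rfl) hcp] with y hy
    rw [hy]
  have hc0 : c = 0 := by
    rw [hzero] at hconst
    have := (mul_eq_zero.1 hconst.symm).resolve_right (hG.measure_pos volume hGne).ne'
    simpa using this
  refine Lp.ext ?_
  filter_upwards [hcp, Lp.coeFn_zero ℝ 2 (volume.restrict Ω)] with y hy hy0
  rw [hy, hy0, hc0]
  rfl

theorem poincare_H1Perp {Ω : Set R3} (hΩ : IsOpen Ω) (hc : IsConnected Ω)
    (hb : Bornology.IsBounded Ω) (hT : IsCompactOperator (toL2 Ω)) :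
    ∃ c : ℝ, 0 < c ∧ ∀ p ∈ H1Perp Ω, ‖toL2 Ω p‖ ≤ c * ‖grad Ω p‖ := by
  have hfin : (volume.restrict Ω) Ω ≠ ⊤ := by
    rw [Measure.restrict_apply_self]
    exact hb.measure_lt_top.ne
  set ℓ := setIntegralCLM Ω Ω hΩ.measurableSet hfin with hℓ
  have happ : ∀ p, ℓ p = ∫ y in Ω, toL2 Ω p y :=
    setIntegralCLM_apply hΩ.measurableSet Subset.rfl hfin
  -- The kernel of the mean-value functional is a closed subspace containing `H1Perp Ω`.
  obtain ⟨c, hc0, h⟩ := exists_poincare_constant hT (V := LinearMap.ker (ℓ : H1 Ω →ₗ[ℝ] ℝ))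
    (ContinuousLinearMap.isClosed_ker ℓ) fun p hp hg => by
      obtain ⟨c, hcp⟩ := exists_ae_eq_const hΩ hc hg
      have h0 : ∫ y in Ω, toL2 Ω p y = 0 := (happ p).symm.trans hp
      rw [integral_congr_ae hcp, setIntegral_const, smul_eq_mul, mul_eq_zero] at h0
      have hc0 : c = 0 := h0.resolve_left (by
        rw [measureReal_def]
        exact (ENNReal.toReal_pos (hΩ.measure_pos volume hc.nonempty).ne'
          hb.measure_lt_top.ne).ne')
      refine Lp.ext ?_
      filter_upwards [hcp, Lp.coeFn_zero ℝ 2 (volume.restrict Ω)] with y hy hy0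
      rw [hy, hy0, hc0]
      rfl
  refine ⟨c, hc0, fun p hp => h p ?_⟩
  have := hp 1
  simp only [mul_one] at this
  exact (happ p).trans this

end WeakLip

theorem mainTheorem11 (Ω Γτ : Set WeakLip.R3) (hΩ_open : IsOpen Ω) (hΩ_conn : IsConnected Ω)
    (hΩ_bdd : Bornology.IsBounded Ω) (hpair : WeakLip.IsWeakLipschitzPair Ω Γτ) :
    IsCompactOperator (WeakLip.embedding Ω Γτ) ∧
      ∃ cp : ℝ, 0 < cp ∧
        (Γτ ≠ ∅ → ∀ u ∈ WeakLip.H1Gamma Ω Γτ,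
          ‖WeakLip.toL2 Ω u‖ ≤ cp * ‖WeakLip.grad Ω u‖) ∧
        (Γτ = ∅ → ∀ u ∈ WeakLip.H1Perp Ω,
          ‖WeakLip.toL2 Ω u‖ ≤ cp * ‖WeakLip.grad Ω u‖) := by
  have hT := WeakLip.isCompactOperator_toL2 hΩ_open hΩ_bdd hpair.1
  refine ⟨hT.comp_clm (WeakLip.H1Gamma Ω Γτ).subtypeL, ?_⟩
  rcases Set.eq_empty_or_nonempty Γτ with h | h
  · obtain ⟨c, hc, hle⟩ := WeakLip.poincare_H1Perp hΩ_open hΩ_conn hΩ_bdd hT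
    exact ⟨c, hc, fun hne => absurd h hne, fun _ => hle⟩
  · obtain ⟨c, hc, hle⟩ := WeakLip.exists_poincare_constant hT
      (Submodule.isClosed_topologicalClosure (WeakLip.testFunctions Ω Γτ))
      fun p hp hg => WeakLip.toL2_eq_zero_of_mem_H1Gamma hΩ_open hΩ_conn hpair h hp hg
    exact ⟨c, hc, fun _ => hle, fun he => absurd he h.ne_empty⟩
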